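/- Let $\chi\in C^\infty(\mathbb R)$ be real-valued and even, with $\chi=0$ in a neighbourhood of $0$ and $\chi(\xi)=1$ for $|\xi|\ge 1$; let $\gamma>0$ and $x>0$. An oscillatory integral $\int e^{i\phi(s,\theta)}a(\theta)\,d\theta$ means the limit in $\mathcal D'(\mathbb R_s)$, as $\varepsilon\to0^+$, of $\int e^{i\phi(s,\theta)}\rho(\varepsilon\theta)a(\theta)\,d\theta$, for every $\rho\in C_c^\infty$ with $\rho=1$ near $0$; it is a *proper* oscillatory integral if moreover $a$ is smooth and, for all $s$ and all $\theta\in\operatorname{supp}a$, $\phi$ is smooth near $(s,\theta)$, positively homogeneous of degree one in $\theta$, and has non-vanishing gradient in $(s,\theta)$. Put $$u_x(s)=\int e^{i(s|\xi|-x\xi)}\frac{\chi(\xi)}{|\xi|}\,d\xi,\qquad v_x(s)=\int e^{i(s|\xi|-x\xi/\gamma)}\frac{\chi(\xi/\gamma)}{\gamma|\xi|}\,d\xi,$$ $$\phi_t(s;\xi,\eta)=s(|\xi|-|\eta|)-t|\eta|-x(\xi-\eta/\gamma),\qquad a(\xi,\eta)=\frac{\chi(\xi)\chi(\eta/\gamma)}{\gamma|\xi||\eta|},$$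 and $(T_tv_x)(s)=v_x(s+t)$. Call $t$ degenerate if $t\in\{\pm x(1+1/\gamma),\ \pm x(1-1/\gamma)\}$. Then $u_x$ and $v_x$ exist as proper oscillatory integrals and there are distributions $w_{x,t}\in\mathcal D'(\mathbb R)$, $t\in\mathbb R$, such that: 1. For every $t$, $w_{x,t}$ is the product $u_x\cdot\overline{T_tv_x}$ in the local Fourier sense: every point of $\mathbb R$ has a real cut-off $f\in C_c^\infty(\mathbb R)$, equal to $1$ near that point, such that for all $k\in\mathbb R$ $$\widehat{f^2w_{x,t}}(k)=\frac1{2\pi}\int\widehat{fu_x}(l)\,\widehat{f\,\overline{T_tv_x}}(k-l)\,dl$$ with absolutely convergent integral, where $\widehat h(k)=\langle h,e^{-ik\cdot}\rangle$. For every non-degenerate $t$ the wave front sets of $u_x$ and $\overline{T_tv_x}$ are in favorable position (no two covectors over the same point add up to $0$), so that $w_{x,t}$ is the Hörmander product. 2. For every $t$, in the sense of the above limit, $$w_{x,t}(s)=\iint e^{i\phi_t(s;\xi,\eta)}\,a(\xi,\eta)\,d\xi\,d\eta,$$ and for every non-degenerate $t$ this is a proper oscillatory integral. 3. For $t\in\mathbb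 R$ let $D_t$ be the set of $(\sigma,\tau)\in\{\pm1\}^2$ with $t=\tau x/\gamma-\sigma x$ (so $D_t\neq\emptyset$ iff $t$ is degenerate). Let $\nu\in C_c^\infty(\mathbb R^2)$ equal $1$ on the closed unit disc, and for $(\sigma,\tau)\in D_t$ let $\mu_{\sigma\tau}\in C^\infty(\mathbb R^2;[0,1])$ have support in $\{\sigma\xi>0,\ \tau\eta>0\}$ and equal $1$ near every point $(\sigma r,\tau r)$ with $r>0$ and $2r^2\ge1$; put $\mu=\sum_{D_t}\mu_{\sigma\tau}$. Then $$w_{x,t}=S+O+\sum_{(\sigma,\tau)\in D_t}F_{\sigma\tau},$$ where $S(s)=\iint e^{i\phi_t}\nu(1-\mu)a\,d\xi\,d\eta$ is a smooth function; $O$ is the proper oscillatory integral with phase $\phi_t$ and amplitude $(1-\nu)(1-\mu)a$; and $F_{\sigma\tau}$ is the (limit) oscillatory integral with phase $\phi_t$ and amplitude $\mu_{\sigma\tau}a\in L^2(\mathbb R^2)$, which is the Fourier transform of an $L^2$ function: $g_{\sigma\tau}(r)=\int(\mu_{\sigma\tau}a)(\sigma(p+r),\tau p)\,dp$ belongs to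 $L^2(\mathbb R)$ and $F_{\sigma\tau}$ is the locally integrable function $s\mapsto\widehat{g_{\sigma\tau}}(\sigma x-s)$, with $\widehat g(k)=\int e^{-ikr}g(r)\,dr$ in the $L^2$ (Plancherel) sense. 4. For every test function $\psi$, the function $t\mapsto\langle w_{x,t},\psi\rangle$ is continuous on $\mathbb R$ and $C^\infty$ on the set of non-degenerate $t$. -/

import Mathlib

open Filter Topology MeasureTheory Set
open scoped ContDiff Distributions FourierTransform

noncomputable section

/-- Real-valued test functions on the line. -/
abbrev TestFn : Type := 𝓓((⊤ : TopologicalSpace.Opens ℝ), ℝ)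

/-- Complex-valued distributions on the line. Following Mathlib they are tested against real test
functions; complex test functions are covered by linearity. -/
abbrev Distr : Type := 𝓓'((⊤ : TopologicalSpace.Opens ℝ), ℂ)

/-! ### Operations on test functions and distributions -/

/-- The translated test function `s ↦ ψ (s - t)`. -/
def TestFn.shift (t : ℝ) (ψ : TestFn) : TestFn where
  toFun s := ψ (s - t)
  contDiff' := ψ.contDiff.comp (contDiff_id.sub contDiff_const)
  hasCompactSupport' := ψ.hasCompactSupport.comp_homeomorph (Homeomorph.subRight t)
  tsupport_subset' := fun _ _ => trivial

/-- The product of a smooth function with a test function. -/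
def TestFn.smulSmooth (g : ℝ → ℝ) (hg : ContDiff ℝ ∞ g) (f : TestFn) : TestFn where
  toFun s := g s * f s
  contDiff' := hg.mul f.contDiff
  hasCompactSupport' := f.hasCompactSupport.mul_left
  tsupport_subset' := fun _ _ => trivial

/-- Translation of test functions supported in a fixed compact set is continuous. -/
def TestFn.shiftOn (t : ℝ) (K : TopologicalSpace.Compacts ℝ) :
    ContDiffMapSupportedIn ℝ ℝ ⊤ K →L[ℝ]
      ContDiffMapSupportedIn ℝ ℝ ⊤ (K.map (· + t) (continuous_add_const t)) :=
  ContDiffMapSupportedIn.mkCLM ℝ (fun f s => f (s - t))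
    (fun _ _ _ => rfl) (fun _ _ _ => rfl)
    (fun f => f.contDiff.comp (contDiff_id.sub contDiff_const))
    (fun f s hs => by
      refine f.zero_on_compl (fun h => hs ?_)
      exact ⟨s - t, h, by simp⟩)
    (fun i _ => ⟨{i}, 1, zero_le_one, fun f s _ => by
      rw [iteratedFDeriv_comp_sub, Finset.sup_singleton, one_mul]
      exact ContDiffMapSupportedIn.norm_iteratedFDeriv_apply_le_seminorm_top ℝ⟩)

/-- Translation of test functions as a continuous linear map. -/
def TestFn.shiftCLM (t : ℝ) : TestFn →L[ℝ] TestFn :=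
  TestFunction.limitCLM ℝ (TestFn.shift t)
    (fun K _ => (TestFunction.ofSupportedInCLM ℝ (Ω := (⊤ : TopologicalSpace.Opens ℝ))
      (K := K.map (· + t) (continuous_add_const t)) (fun _ _ => trivial)).comp
        (TestFn.shiftOn t K))
    (fun _ _ _ => rfl)

/-- The distribution `T_t v`, i.e. `s ↦ v (s + t)`: `⟨T_t v, ψ⟩ = ⟨v, ψ(· - t)⟩`. -/
def Distr.translate (t : ℝ) (v : Distr) : Distr :=
  ContinuousLinearMap.precompCompactConvergenceCLM ℂ (TestFn.shiftCLM t) v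

/-- The complex conjugate of a distribution: `⟨conj v, ψ⟩ = conj ⟨v, ψ⟩` for real `ψ`. -/
def Distr.conj (v : Distr) : Distr :=
  Distribution.mapCLM (Complex.conjCLE : ℂ →L[ℝ] ℂ) v

theorem Distr.conj_translate_apply (t : ℝ) (v : Distr) (ψ : TestFn) :
    (v.translate t).conj ψ = (starRingEnd ℂ) (v (ψ.shift t)) := rfl

/-! ### Wave front set and product -/

/-- The Fourier transform `k ↦ ⟨f u, exp(-i k ·)⟩` of the compactly supported distribution
`f u`. -/
def localFourier (f : TestFn) (u : Distr) (k : ℝ) : ℂ :=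
  u (f.smulSmooth (fun s => Real.cos (k * s))
      (Real.contDiff_cos.comp (contDiff_const.mul contDiff_id)))
    - Complex.I * u (f.smulSmooth (fun s => Real.sin (k * s))
      (Real.contDiff_sin.comp (contDiff_const.mul contDiff_id)))

/-- The wave front set of a distribution on the line: `(s₀, k₀)` with `k₀ ≠ 0` is not in it iff
for some test function `f` with `f s₀ ≠ 0` the Fourier transform of `f u` decays rapidly on the
open half-line (the conic neighbourhood) through `k₀`. -/
def waveFrontSet (u : Distr) : Set (ℝ × ℝ) :=
  {p | p.2 ≠ 0 ∧ ¬ ∃ f : TestFn, f p.1 ≠ 0 ∧ ∀ N : ℕ, ∃ C : ℝ, ∀ k : ℝ, 0 < k * p.2 →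
    ‖localFourier f u k‖ * (1 + |k|) ^ N ≤ C}

/-- Favorable position: no covectors of the two wave front sets over the same point add up
to zero. -/
def WFFavorable (u v : Distr) : Prop :=
  ∀ s k : ℝ, (s, k) ∈ waveFrontSet u → (s, -k) ∉ waveFrontSet v

/-- `w` is the (local Fourier) product of the distributions `u` and `v`: near every point there is
a cut-off `f`, equal to `1` near that point, such that the Fourier transform of `f² w` is `1/(2π)`
times the absolutely convergent convolution of the Fourier transforms of `f u` and `f v`.
This is the formula for the pull-back of `f u ⊗ f v` under the diagonal map `s ↦ (s, s)`. -/
def IsFourierProduct (u v w : Distr) : Prop :=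
  ∀ s₀ : ℝ, ∃ f : TestFn, (∀ᶠ s in 𝓝 s₀, f s = 1) ∧ ∀ k : ℝ,
    Integrable (fun l : ℝ => localFourier f u l * localFourier f v (k - l)) ∧
    localFourier (f.smulSmooth f f.contDiff) w k =
      (1 / (2 * Real.pi) : ℝ) * ∫ l : ℝ, localFourier f u l * localFourier f v (k - l)

/-- `w` is the Hörmander product of `u` and `v`: the wave front sets are in favorable position
and `w` is the pull-back of `u ⊗ v` to the diagonal, computed locally by Fourier transform. -/
def IsHormanderProduct (u v w : Distr) : Prop :=
  WFFavorable u v ∧ IsFourierProduct u v w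

/-! ### Oscillatory integrals -/

section OscInt

variable {E : Type} [NormedAddCommGroup E] [NormedSpace ℝ E]

/-- `φ` is a phase function on `ℝ × A`: at all `s` and all `θ ∈ A` it is smooth, positively
homogeneous of degree one in `θ`, and its full gradient in `(s, θ)` does not vanish. -/
def IsPhaseFunctionOn (φ : ℝ → E → ℝ) (A : Set E) : Prop :=
  ∀ s : ℝ, ∀ θ ∈ A,
    (∀ r : ℝ, 0 < r → φ s (r • θ) = r * φ s θ) ∧
    ContDiffAt ℝ ∞ (fun p : ℝ × E => φ p.1 p.2) (s, θ) ∧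
    fderiv ℝ (fun p : ℝ × E => φ p.1 p.2) (s, θ) ≠ 0

variable [MeasureSpace E]

/-- `u` is the distributional limit of the cut-off integrals
`∫ ρ(ε θ) a(θ) exp(i φ(s, θ)) dθ` as `ε → 0+`, for every smooth compactly supported `ρ` equal to
`1` near `0`. -/
def IsCutoffLimit (φ : ℝ → E → ℝ) (a : E → ℝ) (u : Distr) : Prop :=
  ∀ ρ : E → ℝ, ContDiff ℝ ∞ ρ → HasCompactSupport ρ → (∀ᶠ θ in 𝓝 0, ρ θ = 1) →
    ∀ ψ : TestFn,
      Tendsto (fun ε : ℝ => ∫ s : ℝ, (ψ s : ℂ) *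
          ∫ θ : E, ((ρ (ε • θ) * a θ : ℝ) : ℂ) * Complex.exp (Complex.I * (φ s θ : ℂ)))
        (𝓝[>] 0) (𝓝 (u ψ))

/-- `u` is the oscillatory integral `∫ a(θ) exp(i φ(·, θ)) dθ`: the amplitude is smooth, `φ` is a
phase function on its support, and `u` is the limit of the cut-off integrals. -/
structure IsOscInt (φ : ℝ → E → ℝ) (a : E → ℝ) (u : Distr) : Prop where
  smooth_amplitude : ContDiff ℝ ∞ a
  phase : IsPhaseFunctionOn φ (tsupport a)
  limit : IsCutoffLimit φ a u

end OscInt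

/-! ### The phases and amplitudes at hand -/

/-- The phase `s|ξ| - y ξ`; `u_x` has `y = x` and `v_x` has `y = x / γ`. -/
def wavePhase (y s ξ : ℝ) : ℝ := s * |ξ| - y * ξ

/-- The amplitude `χ(ξ / γ) / (γ |ξ|)` of `v_x`; `u_x` has `γ = 1`. -/
def waveAmp (χ : ℝ → ℝ) (γ ξ : ℝ) : ℝ := χ (ξ / γ) / (γ * |ξ|)

/-- `φ_t(s; ξ, η) = s(|ξ| - |η|) - t|η| - x(ξ - η/γ)`. -/
def corrPhase (x γ t s : ℝ) (p : ℝ × ℝ) : ℝ :=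
  s * (|p.1| - |p.2|) - t * |p.2| - x * (p.1 - p.2 / γ)

/-- `a(ξ, η) = χ(ξ) χ(η/γ) / (γ |ξ| |η|)`. -/
def corrAmp (χ : ℝ → ℝ) (γ : ℝ) (p : ℝ × ℝ) : ℝ :=
  χ p.1 * χ (p.2 / γ) / (γ * |p.1| * |p.2|)

/-- The degenerate times `±x(1 + 1/γ)`, `±x(1 - 1/γ)`. -/
def degenerateTimes (x γ : ℝ) : Set ℝ :=
  {x * (1 + 1 / γ), -(x * (1 + 1 / γ)), x * (1 - 1 / γ), -(x * (1 - 1 / γ))}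

/-- The sign pairs `(σ, τ)` whose half-ray `{(σ r, τ r) | r > 0}` consists of critical frequencies
of `φ_t` (at `s = σ x`), i.e. those with `t = τ x/γ - σ x`. -/
def criticalRays (x γ t : ℝ) : Finset (ℝ × ℝ) :=
  open scoped Classical in
  ({(1, 1), (1, -1), (-1, 1), (-1, -1)} : Finset (ℝ × ℝ)).filter
    (fun q => t = q.2 * x / γ - q.1 * x)

/-- `∫ b(σ(p + r), τ p) dp`, the integral of `b` over the line `σ ξ - τ η = r`. -/
def lineIntegral (b : ℝ × ℝ → ℝ) (q : ℝ × ℝ) (r : ℝ) : ℂ :=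
  ∫ p : ℝ, ((b (q.1 * (p + r), q.2 * p) : ℝ) : ℂ)

/-- A cut-off near the half-ray with sign pair `q = (σ, τ)`: smooth, with values in `[0, 1]`,
supported in the open quadrant of the half-ray and equal to `1` near the part of the half-ray
outside the open unit disc. -/
structure IsRayCutoff (q : ℝ × ℝ) (μ : ℝ × ℝ → ℝ) : Prop where
  smooth : ContDiff ℝ ∞ μ
  mem_Icc : ∀ p, μ p ∈ Icc (0 : ℝ) 1
  support : tsupport μ ⊆ {p | 0 < q.1 * p.1 ∧ 0 < q.2 * p.2}
  eq_one : ∀ r : ℝ, 0 < r → 1 ≤ r ^ 2 + r ^ 2 → ∀ᶠ p in 𝓝 (q.1 * r, q.2 * r), μ p = 1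

/-- A low-frequency cut-off: smooth with compact support and equal to `1` on the closed unit
disc. -/
structure IsLowCutoff (ν : ℝ × ℝ → ℝ) : Prop where
  smooth : ContDiff ℝ ∞ ν
  compact : HasCompactSupport ν
  eq_one : ∀ p : ℝ × ℝ, p.1 ^ 2 + p.2 ^ 2 ≤ 1 → ν p = 1

end

/-! Every distribution involved has the form `∫ c(θ) exp(i s h(θ)) dθ`, so its value at `ψ` is `∫
c(θ) ψ̂(h(θ)) dθ`, where `ψ̂` is `waveFT ψ`. Since `ψ̂` decays rapidly, it is enough that `c / (1 +
h²)` is integrable. This condition, `OscIntegrable`, makes the integral absolutely convergent, gives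
continuity in `ψ`, and gives independence of the cut-off by dominated convergence
(`isCutoffLimit_oscDistr`).

The correlation has frequency `h = |ξ| - |η|` and amplitude of size `1 / ((1 + |ξ|)(1 + |η|))`. That
amplitude is not integrable on the plane, but decay in `h` confines the integral to strips about the
lines `η = ±ξ`, where the amplitude falls off quadratically (`integrable_corr_majorant`). So the
double integral converges weakly for every `t`, degenerate or not. By Fubini and the convolution
theorem it is the local Fourier product of the factors (`isFourierProduct_oscDistr`). Continuity in
`t` follows as well, because `t` enters only through a unimodular factor.

Degenerate times matter for geometry and for smoothness. On a half-line the phase of a factor is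
linear and its amplitude is a symbol, so repeated integration by parts gives rapid decay of the
local transform away from `s = ±y`. The singular supports of the two factors meet only at degenerate
`t`. The gradient of `φ_t` vanishes only where `|ξ| = |η|`, `s = σ x` and `s + t = τ x / γ`, that
is, on the half-rays in `criticalRays`.

In the quadrant with signs `(σ, τ)`, put `ξ = σ(p + r)`, `η = τ p`. The phase becomes `s r + p (τ x
/ γ - σ x - t) - σ x r`. Integrating over `r` first leaves the Fourier integral of a symbol of order
`-2` in `p`, which is smooth in `t` wherever the coefficient of `p` is nonzero. If that coefficient
vanishes, integrating over `p` first produces the line integral of the amplitude, which is `O((1 +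
|r|)^(-3/4))` and hence square integrable; Plancherel identifies the contribution. The decomposition
is the partition `1 = ν(1 - μ) + (1 - ν)(1 - μ) + μ` applied to the amplitude. -/

noncomputable section

/-! ### The Fourier transform of test functions -/

/-- The Fourier transform `k ↦ ∫ g(s) exp(i s k) ds`. -/
def waveFT (g : ℝ → ℝ) (k : ℝ) : ℂ := ∫ s : ℝ, (g s : ℂ) * Complex.exp (Complex.I * (s * k : ℝ))

theorem norm_exp_I_mul_ofReal (r : ℝ) : ‖Complex.exp (Complex.I * (r : ℂ))‖ = 1 := by
  rw [mul_comm, Complex.norm_exp_ofReal_mul_I]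

theorem waveFT_eq_fourier (g : ℝ → ℝ) (k : ℝ) :
    waveFT g k = 𝓕 (fun s => (g s : ℂ)) (-(k / (2 * Real.pi))) := by
  rw [Real.fourier_eq', waveFT]
  congr 1
  ext s
  have : -2 * Real.pi * inner ℝ s (-(k / (2 * Real.pi))) = s * k := by
    simp only [RCLike.inner_apply, conj_trivial]
    field_simp [Real.pi_ne_zero]
  rw [this, smul_eq_mul, mul_comm, mul_comm Complex.I]

/-- A smooth compactly supported function as a complex Schwartz function. -/
def toSchwartz (g : ℝ → ℝ) (hg : ContDiff ℝ ∞ g) (hc : HasCompactSupport g) : SchwartzMap ℝ ℂ :=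
  HasCompactSupport.toSchwartzMap (f := fun s => (g s : ℂ))
    (hc.comp_left (g := fun r : ℝ => (r : ℂ)) Complex.ofReal_zero)
    (Complex.ofRealCLM.contDiff.comp hg)

theorem toSchwartz_apply (g : ℝ → ℝ) (hg : ContDiff ℝ ∞ g) (hc : HasCompactSupport g) (s : ℝ) :
    toSchwartz g hg hc s = g s := rfl

theorem exists_schwartz_waveFT (g : ℝ → ℝ) (hg : ContDiff ℝ ∞ g) (hc : HasCompactSupport g) :
    ∃ Φ : SchwartzMap ℝ ℂ, ∀ k, waveFT g k = Φ k := by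
  have hne : (-(1 / (2 * Real.pi)) : ℝ) ≠ 0 := by simp [Real.pi_ne_zero]
  refine ⟨SchwartzMap.compCLMOfContinuousLinearEquiv ℂ
    (ContinuousLinearEquiv.unitsEquivAut ℝ (Units.mk0 _ hne)) (𝓕 (toSchwartz g hg hc)), fun k => ?_⟩
  rw [waveFT_eq_fourier, SchwartzMap.compCLMOfContinuousLinearEquiv_apply]
  simp only [Function.comp_apply, SchwartzMap.fourier_coe,
    ContinuousLinearEquiv.unitsEquivAut_apply, Units.val_mk0]
  have h2 : -(k / (2 * Real.pi)) = k * -(1 / (2 * Real.pi)) := by ring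
  rw [h2]
  rfl

/-- The factor `k²` is absorbed by passing to the second derivative. The right side is kept explicit
because it must be controlled by the seminorms of orders 0 and 2 when continuity of `oscDistr` is
proved. -/
theorem waveFT_norm_le (g : ℝ → ℝ) (hg : ContDiff ℝ ∞ g) (hc : HasCompactSupport g) (k : ℝ) :
    (1 + k ^ 2) * ‖waveFT g k‖ ≤ (∫ s, ‖g s‖) + ∫ s, ‖iteratedFDeriv ℝ 2 g s‖ := by
  set G := toSchwartz g hg hc
  have hG : ContDiff ℝ ∞ G := G.smooth ⊤
  have h1 : ‖waveFT g k‖ ≤ ∫ s, ‖g s‖ := by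
    refine (norm_integral_le_integral_norm _).trans (le_of_eq ?_)
    simp only [norm_mul, norm_exp_I_mul_ofReal, mul_one, Complex.norm_real]
  have h2 : k ^ 2 * ‖waveFT g k‖ ≤ ∫ s, ‖iteratedFDeriv ℝ 2 g s‖ := by
    have hint : ∀ n : ℕ, (n : ℕ∞) ≤ 2 → Integrable (iteratedDeriv n G) := by
      intro n _
      refine Continuous.integrable_of_hasCompactSupport
        (hG.continuous_iteratedDeriv n (by exact_mod_cast le_top)) ?_
      have : HasCompactSupport (G : ℝ → ℂ) :=
        hc.comp_left (g := fun r : ℝ => (r : ℂ)) Complex.ofReal_zero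
      refine (this.iteratedFDeriv (𝕜 := ℝ) n).mono fun s hs => ?_
      rw [Function.mem_support, iteratedDeriv_eq_iteratedFDeriv] at hs
      intro h0
      exact hs (by rw [h0]; rfl)
    have h := congrFun (Real.fourier_iteratedDeriv (f := G) (N := 2) (n := 2)
      (hG.of_le (by exact_mod_cast le_top)) hint le_rfl) (-(k / (2 * Real.pi)))
    have h3 : ‖𝓕 (iteratedDeriv 2 G) (-(k / (2 * Real.pi)))‖ = k ^ 2 * ‖waveFT g k‖ := by
      rw [h, waveFT_eq_fourier, smul_eq_mul, norm_mul, norm_pow]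
      congr 1
      have : (2 * Real.pi * Complex.I * ((-(k / (2 * Real.pi)) : ℝ) : ℂ)) =
          (-k : ℝ) * Complex.I := by
        push_cast
        have := Complex.ofReal_ne_zero.2 Real.pi_ne_zero
        field_simp
      rw [this, norm_mul, Complex.norm_I, mul_one, Complex.norm_real, Real.norm_eq_abs, sq_abs,
        neg_sq]
    rw [← h3]
    have h4 : ∀ s, ‖iteratedDeriv 2 G s‖ = ‖iteratedFDeriv ℝ 2 g s‖ := by
      intro s
      rw [norm_iteratedFDeriv_eq_norm_iteratedDeriv]
      have h5 : iteratedDeriv 2 G s = ((iteratedDeriv 2 g s : ℝ) : ℂ) := by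
        have hd : ∀ f : ℝ → ℝ, Differentiable ℝ f →
            deriv (fun s => (f s : ℂ)) = fun s => ((deriv f s : ℝ) : ℂ) := by
          intro f hf
          ext s
          exact (hf s).hasDerivAt.ofReal_comp.deriv
        rw [iteratedDeriv_succ, iteratedDeriv_succ (f := g), iteratedDeriv_one, iteratedDeriv_one]
        have : (G : ℝ → ℂ) = fun s => (g s : ℂ) := rfl
        rw [this, hd g (hg.differentiable (by simp)), hd]
        have := hg.differentiable_iteratedDeriv 1 (by exact_mod_cast ENat.natCast_lt_top 1)
        rwa [iteratedDeriv_one] at this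
      rw [h5, Complex.norm_real]
    refine (VectorFourier.norm_fourierIntegral_le_integral_norm _ _ _ _ _).trans (le_of_eq ?_)
    simp only [h4]
  linarith

theorem contDiff_waveFT {g : ℝ → ℝ} (hg : ContDiff ℝ ∞ g) (hc : HasCompactSupport g) :
    ContDiff ℝ ∞ (waveFT g) := by
  obtain ⟨Φ, hΦ⟩ := exists_schwartz_waveFT g hg hc
  rw [funext hΦ]
  exact Φ.smooth ⊤

/-- The Fourier transform of a test function decays rapidly. -/
theorem exists_waveFT_decay {g : ℝ → ℝ} (hg : ContDiff ℝ ∞ g) (hc : HasCompactSupport g) (n : ℕ) :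
    ∃ C : ℝ, 0 ≤ C ∧ ∀ k, (1 + |k|) ^ n * ‖waveFT g k‖ ≤ C := by
  obtain ⟨Φ, hΦ⟩ := exists_schwartz_waveFT g hg hc
  have h := fun k => SchwartzMap.one_add_le_sup_seminorm_apply (𝕜 := ℝ) (m := (n, 0))
    (k := n) (n := 0) le_rfl le_rfl Φ k
  simp only [norm_iteratedFDeriv_zero, Real.norm_eq_abs] at h
  exact ⟨_, le_trans (by positivity) (h 0), fun k => by rw [hΦ]; exact h k⟩

/-! ### Oscillatory distributions -/

section OscDistr

variable {E : Type} [MeasureSpace E]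

/-- Local integrability condition for the distribution `∫ c(θ) exp(i s h(θ)) dθ`. -/
def OscIntegrable (c : E → ℂ) (h : E → ℝ) : Prop :=
  Measurable h ∧ Integrable (fun θ => c θ * ((1 + h θ ^ 2)⁻¹ : ℝ))

/-- Multiply and divide by `1 + h²`: one factor is integrable by assumption, the other bounded. -/
theorem integrable_mul_of_decay {c : E → ℂ} {h : E → ℝ} (hc : OscIntegrable c h)
    {F : E → ℂ} (hF : AEStronglyMeasurable F) {C : ℝ} (hb : ∀ θ, (1 + h θ ^ 2) * ‖F θ‖ ≤ C) :
    Integrable (fun θ => c θ * F θ) := by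
  have : (fun θ => c θ * F θ) =
      fun θ => (c θ * ((1 + h θ ^ 2)⁻¹ : ℝ)) * (((1 + h θ ^ 2 : ℝ) : ℂ) * F θ) := by
    ext θ
    have : (0:ℝ) < 1 + h θ ^ 2 := by positivity
    have h' : ((1 + h θ ^ 2 : ℝ) : ℂ) ≠ 0 := by exact_mod_cast this.ne'
    rw [Complex.ofReal_inv]
    field_simp
  rw [this]
  refine hc.2.mul_bdd (c := C) ?_ (Eventually.of_forall fun θ => ?_)
  · refine AEStronglyMeasurable.mul ?_ hF
    exact (Complex.measurable_ofReal.comp ((hc.1.pow_const 2).const_add 1)).aestronglyMeasurable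
  · rw [norm_mul, Complex.norm_real, Real.norm_of_nonneg (by positivity)]
    exact hb θ

theorem integrable_mul_waveFT {c : E → ℂ} {h : E → ℝ} (hc : OscIntegrable c h) {g : ℝ → ℝ}
    (hg : ContDiff ℝ ∞ g) (hs : HasCompactSupport g) :
    Integrable (fun θ => c θ * waveFT g (h θ)) :=
  integrable_mul_of_decay hc
    ((contDiff_waveFT hg hs).continuous.measurable.comp hc.1).aestronglyMeasurable
    (fun θ => waveFT_norm_le g hg hs (h θ))

theorem integrable_testFn_mul_exp (ψ : TestFn) (k : ℝ) :
    Integrable fun s : ℝ => (ψ s : ℂ) * Complex.exp (Complex.I * (s * k : ℝ)) := by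
  refine Continuous.integrable_of_hasCompactSupport ?_ ?_
  · exact (Complex.continuous_ofReal.comp ψ.continuous).mul (by fun_prop)
  · exact (ψ.hasCompactSupport.comp_left (g := fun r : ℝ => (r : ℂ)) Complex.ofReal_zero).mul_right

theorem waveFT_add (f g : TestFn) (k : ℝ) :
    waveFT (f + g : TestFn) k = waveFT f k + waveFT g k := by
  rw [waveFT, waveFT, waveFT,
    ← integral_add (integrable_testFn_mul_exp f k) (integrable_testFn_mul_exp g k)]
  congr 1
  ext s
  simp [add_mul]

theorem waveFT_smul (r : ℝ) (g : TestFn) (k : ℝ) :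
    waveFT (r • g : TestFn) k = r * waveFT g k := by
  rw [waveFT, waveFT, ← integral_const_mul]
  congr 1
  ext s
  simp [mul_assoc]

/-- The distribution `∫ c(θ) exp(i s h(θ)) dθ`. -/
def oscDistr (c : E → ℂ) (h : E → ℝ) (hc : OscIntegrable c h) : Distr :=
  TestFunction.mkCLM ℝ (fun ψ : TestFn => ∫ θ, c θ * waveFT ψ (h θ))
    (fun f g => by
      rw [← integral_add (integrable_mul_waveFT hc f.contDiff f.hasCompactSupport)
        (integrable_mul_waveFT hc g.contDiff g.hasCompactSupport)]
      congr 1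
      ext θ
      rw [waveFT_add, mul_add])
    (fun r f => by
      rw [Complex.real_smul, ← integral_const_mul]
      congr 1
      ext θ
      rw [waveFT_smul]
      ring)
    (fun K hK => by
      let Φ := ContDiffMapSupportedIn.mkCLMtoNormedSpace (𝕜 := ℝ) (E := ℝ) (F := ℝ) (n := ⊤)
        (K := K) (fun f => ∫ θ, c θ * waveFT (TestFunction.ofSupportedIn hK f) (h θ))
        ?_ ?_ ?_
      · exact Φ.continuous
      · intro f g
        refine Eq.trans ?_ (integral_add (integrable_mul_waveFT hc f.contDiff f.hasCompactSupport)
          (integrable_mul_waveFT hc g.contDiff g.hasCompactSupport))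
        congr 1
        ext θ
        rw [← mul_add]
        congr 1
        exact waveFT_add (TestFunction.ofSupportedIn hK f) (TestFunction.ofSupportedIn hK g) (h θ)
      · intro r f
        rw [Complex.real_smul, ← integral_const_mul]
        congr 1
        ext θ
        rw [mul_left_comm, ← waveFT_smul]
        rfl
      -- Each of the two integrals in `waveFT_norm_le` is at most `vol K` times the supremum `p` of
      -- the two seminorms, whence the factor `2 * vol K`.
      · refine ⟨{0, 2}, (∫ θ, ‖c θ * ((1 + h θ ^ 2)⁻¹ : ℝ)‖) * (2 * (volume (K : Set ℝ)).toReal),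
          by positivity, fun f => ?_⟩
        set p := (({0, 2} : Finset ℕ).sup
          fun i => ContDiffMapSupportedIn.seminorm ℝ ℝ ℝ ⊤ K i) f
        have hp : ∀ i ∈ ({0, 2} : Finset ℕ), ∀ s, ‖iteratedFDeriv ℝ i f s‖ ≤ p := by
          intro i hi s
          refine (ContDiffMapSupportedIn.norm_iteratedFDeriv_apply_le_seminorm_top ℝ).trans ?_
          exact Seminorm.le_def.1 (Finset.le_sup (f := fun i =>
            ContDiffMapSupportedIn.seminorm ℝ ℝ ℝ ⊤ K i) hi) f
        have hI : ∀ i ∈ ({0, 2} : Finset ℕ),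
            ∫ s, ‖iteratedFDeriv ℝ i f s‖ ≤ (volume (K : Set ℝ)).toReal * p := by
          intro i hi
          have hz : ∀ s, s ∉ (K : Set ℝ) → ‖iteratedFDeriv ℝ i f s‖ = 0 := by
            intro s hs
            rw [f.iteratedFDeriv_zero_on_compl hs]
            simp
          rw [← setIntegral_eq_integral_of_forall_compl_eq_zero hz]
          have hfin : volume (K : Set ℝ) < ⊤ := K.isCompact.measure_lt_top
          have := setIntegral_mono_on (μ := volume) (s := (K : Set ℝ))
            (f := fun s => ‖iteratedFDeriv ℝ i f s‖) (g := fun _ => p) ?_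
            (integrableOn_const hfin.ne) K.isCompact.measurableSet (fun s _ => hp i hi s)
          · simpa [setIntegral_const, Measure.real] using this
          · refine ContinuousOn.integrableOn_compact K.isCompact (Continuous.continuousOn ?_)
            exact (f.contDiff.continuous_iteratedFDeriv (by exact_mod_cast le_top)).norm
        have hF : ∀ θ, (1 + h θ ^ 2) * ‖waveFT f (h θ)‖ ≤ 2 * (volume (K : Set ℝ)).toReal * p := by
          intro θ
          have h0 := hI 0 (by simp)
          have h2 := hI 2 (by simp)
          simp only [norm_iteratedFDeriv_zero] at h0
          have := waveFT_norm_le f f.contDiff f.hasCompactSupport (h θ)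
          linarith
        refine (norm_integral_le_integral_norm _).trans ?_
        rw [mul_assoc, ← integral_mul_const]
        refine integral_mono_of_nonneg (Eventually.of_forall fun _ => norm_nonneg _)
          (hc.2.norm.mul_const _) (Eventually.of_forall fun θ => ?_)
        have hpos : (0:ℝ) < 1 + h θ ^ 2 := by positivity
        simp only [norm_mul, Complex.norm_real, Real.norm_eq_abs, abs_inv, abs_of_pos hpos]
        rw [mul_assoc]
        refine mul_le_mul_of_nonneg_left ?_ (norm_nonneg _)
        rw [← div_eq_inv_mul, le_div_iff₀ hpos, mul_comm]
        exact hF θ)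

theorem oscDistr_apply (c : E → ℂ) (h : E → ℝ) (hc : OscIntegrable c h) (ψ : TestFn) :
    oscDistr c h hc ψ = ∫ θ, c θ * waveFT ψ (h θ) := rfl

end OscDistr

theorem continuous_exp_I_mul {X : Type*} [TopologicalSpace X] {g : X → ℝ} (hg : Continuous g) :
    Continuous fun x => Complex.exp (Complex.I * (g x : ℂ)) :=
  Complex.continuous_exp.comp (continuous_const.mul (Complex.continuous_ofReal.comp hg))

section CutoffLimit

variable {E : Type} [NormedAddCommGroup E] [MeasureSpace E] [BorelSpace E]
  [SecondCountableTopology E] [IsFiniteMeasureOnCompacts (volume : Measure E)]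
  [SFinite (volume : Measure E)]

/-- Exchange of integrals for compactly supported amplitudes. -/
theorem integral_mul_integral_exp {b h g : E → ℝ} (hb : Continuous b) (hbc : HasCompactSupport b)
    (hh : Continuous h) (hg : Continuous g) {φ : ℝ → E → ℝ} (hφ : ∀ s θ, φ s θ = s * h θ + g θ)
    (ψ : TestFn) :
    ∫ s : ℝ, (ψ s : ℂ) * ∫ θ : E, ((b θ : ℝ) : ℂ) * Complex.exp (Complex.I * (φ s θ : ℂ)) =
      ∫ θ : E, (b θ : ℂ) * Complex.exp (Complex.I * (g θ : ℂ)) * waveFT ψ (h θ) := by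
  have hφc : Continuous fun p : ℝ × E => φ p.1 p.2 := by
    simp only [hφ]
    fun_prop
  have hint : Integrable (fun p : ℝ × E => (ψ p.1 : ℂ) *
      (((b p.2 : ℝ) : ℂ) * Complex.exp (Complex.I * (φ p.1 p.2 : ℂ)))) (volume.prod volume) := by
    refine Continuous.integrable_of_hasCompactSupport ?_ ?_
    · exact (Complex.continuous_ofReal.comp (ψ.continuous.comp continuous_fst)).mul
        ((Complex.continuous_ofReal.comp (hb.comp continuous_snd)).mul (continuous_exp_I_mul hφc))
    · refine HasCompactSupport.intro (ψ.hasCompactSupport.isCompact.prod hbc.isCompact) ?_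
      rintro ⟨s, θ⟩ hp
      rw [mem_prod, not_and_or] at hp
      rcases hp with hp | hp
      · simp [image_eq_zero_of_notMem_tsupport hp]
      · simp [image_eq_zero_of_notMem_tsupport hp]
  simp_rw [← integral_const_mul]
  rw [integral_integral_swap hint]
  congr 1
  ext θ
  rw [waveFT, ← integral_const_mul]
  congr 1
  ext s
  rw [hφ]
  push_cast
  rw [mul_add, Complex.exp_add]
  ring

/-- The cut-off integrals converge as soon as the amplitude is integrable against the decay of the
transform of test functions. -/
theorem isCutoffLimit_oscDistr [NormedSpace ℝ E] {a h g : E → ℝ} (ha : Continuous a) (hh : Continuous h)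
    (hg : Continuous g) {φ : ℝ → E → ℝ} (hφ : ∀ s θ, φ s θ = s * h θ + g θ)
    (hc : OscIntegrable (fun θ => (a θ : ℂ) * Complex.exp (Complex.I * (g θ : ℂ))) h) :
    IsCutoffLimit φ a (oscDistr _ h hc) := by
  intro ρ hρ hρc hρ1 ψ
  obtain ⟨M, hM⟩ := hρ.continuous.bounded_above_of_compact_support hρc
  have hcont : Continuous fun θ => waveFT ψ (h θ) :=
    (contDiff_waveFT ψ.contDiff ψ.hasCompactSupport).continuous.comp hh
  have heq : (fun ε : ℝ => ∫ θ : E, ((ρ (ε • θ) * a θ : ℝ) : ℂ) *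
      Complex.exp (Complex.I * (g θ : ℂ)) * waveFT ψ (h θ)) =ᶠ[𝓝[>] 0]
      (fun ε : ℝ => ∫ s : ℝ, (ψ s : ℂ) *
          ∫ θ : E, ((ρ (ε • θ) * a θ : ℝ) : ℂ) * Complex.exp (Complex.I * (φ s θ : ℂ))) := by
    filter_upwards [self_mem_nhdsWithin] with ε hε
    have hε : (0 : ℝ) < ε := hε
    refine (integral_mul_integral_exp (b := fun θ => ρ (ε • θ) * a θ) ?_ ?_ hh hg hφ ψ).symm
    · exact (hρ.continuous.comp (continuous_const_smul ε)).mul ha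
    · exact (hρc.comp_smul hε.ne').mul_right
  refine Tendsto.congr' heq ?_
  rw [oscDistr_apply]
  have hint := integrable_mul_waveFT hc ψ.contDiff ψ.hasCompactSupport
  -- For fixed `θ` the cut-off `ρ (ε θ)` is eventually 1, and `M` bounds it uniformly in `ε`, so the
  -- uncut integrand times `M` dominates.
  refine tendsto_integral_filter_of_dominated_convergence
    (fun θ => M * ‖(a θ : ℂ) * Complex.exp (Complex.I * (g θ : ℂ)) * waveFT ψ (h θ)‖) ?_ ?_
    (hint.norm.const_mul M) ?_
  · refine Eventually.of_forall fun ε => Continuous.aestronglyMeasurable ?_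
    exact ((Complex.continuous_ofReal.comp ((hρ.continuous.comp
      (continuous_const_smul ε)).mul ha)).mul (continuous_exp_I_mul hg)).mul hcont
  · refine Eventually.of_forall fun ε => Eventually.of_forall fun θ => ?_
    rw [Complex.ofReal_mul, mul_assoc, mul_assoc, norm_mul, Complex.norm_real, mul_assoc]
    exact mul_le_mul_of_nonneg_right (hM _) (norm_nonneg _)
  · refine Eventually.of_forall fun θ => ?_
    have h0 : Tendsto (fun ε : ℝ => ε • θ) (𝓝[>] 0) (𝓝 0) := by
      have : Tendsto (fun ε : ℝ => ε • θ) (𝓝 0) (𝓝 ((0 : ℝ) • θ)) :=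
        (continuous_id.smul continuous_const).tendsto 0
      rw [zero_smul] at this
      exact this.mono_left nhdsWithin_le_nhds
    refine Tendsto.congr' ?_ tendsto_const_nhds
    filter_upwards [h0.eventually hρ1] with ε hε
    rw [hε, one_mul]

end CutoffLimit

/-! ### Local Fourier transforms of oscillatory distributions -/

section LocalFourier

variable {E : Type} [MeasureSpace E]

/-- Cosine and sine combine to `exp(-i k s)`, and modulation shifts the transform. Test functions
being real, the exponential is only available in these two parts. -/
theorem waveFT_cos_sub_sin (f : TestFn) (k l : ℝ) :
    waveFT (f.smulSmooth (fun s => Real.cos (k * s))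
      (Real.contDiff_cos.comp (contDiff_const.mul contDiff_id))) l
    - Complex.I * waveFT (f.smulSmooth (fun s => Real.sin (k * s))
      (Real.contDiff_sin.comp (contDiff_const.mul contDiff_id))) l = waveFT f (l - k) := by
  rw [waveFT, waveFT, ← integral_const_mul, ← integral_sub (integrable_testFn_mul_exp _ l)
    ((integrable_testFn_mul_exp _ l).const_mul _), waveFT]
  congr 1
  ext s
  have h1 : Complex.exp (Complex.I * (s * (l - k) : ℝ)) =
      Complex.exp (Complex.I * (s * l : ℝ)) *
        (Complex.cos (k * s : ℝ) - Complex.I * Complex.sin (k * s : ℝ)) := by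
    have : Complex.cos (k * s : ℝ) - Complex.I * Complex.sin (k * s : ℝ) =
        Complex.exp (-(k * s : ℝ) * Complex.I) := by
      rw [Complex.exp_mul_I, Complex.cos_neg, Complex.sin_neg]
      ring
    rw [this, ← Complex.exp_add]
    congr 1
    push_cast
    ring
  rw [h1]
  change ((Real.cos (k * s) * f s : ℝ) : ℂ) * _ - _ * (((Real.sin (k * s) * f s : ℝ) : ℂ) * _) = _
  push_cast
  ring

theorem localFourier_oscDistr (f : TestFn) (c : E → ℂ) (h : E → ℝ) (hc : OscIntegrable c h)
    (k : ℝ) : localFourier f (oscDistr c h hc) k = ∫ θ, c θ * waveFT f (h θ - k) := by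
  rw [localFourier, oscDistr_apply, oscDistr_apply, ← integral_const_mul, ← integral_sub]
  · congr 1
    ext θ
    rw [← waveFT_cos_sub_sin]
    ring
  · exact integrable_mul_waveFT hc (TestFunction.contDiff _) (TestFunction.hasCompactSupport _)
  · exact (integrable_mul_waveFT hc (TestFunction.contDiff _) (TestFunction.hasCompactSupport _)).const_mul _

theorem conj_waveFT (g : ℝ → ℝ) (k : ℝ) : starRingEnd ℂ (waveFT g k) = waveFT g (-k) := by
  rw [waveFT, ← integral_conj, waveFT]
  congr 1
  ext s
  rw [map_mul, Complex.conj_ofReal, ← Complex.exp_conj, map_mul, Complex.conj_I,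
    Complex.conj_ofReal]
  push_cast
  ring_nf

theorem waveFT_shift (t : ℝ) (ψ : TestFn) (k : ℝ) :
    waveFT (ψ.shift t) k = Complex.exp (Complex.I * (t * k : ℝ)) * waveFT ψ k := by
  rw [waveFT, waveFT, ← integral_const_mul,
    ← integral_sub_right_eq_self (fun s => Complex.exp (Complex.I * (t * k : ℝ)) *
      ((ψ s : ℂ) * Complex.exp (Complex.I * (s * k : ℝ)))) t]
  congr 1
  ext s
  rw [mul_left_comm, ← Complex.exp_add]
  change (ψ (s - t) : ℂ) * _ = _
  congr 2
  push_cast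
  ring

theorem OscIntegrable.conj_translate {c : E → ℂ} {h : E → ℝ} (hc : OscIntegrable c h) (t : ℝ) :
    OscIntegrable (fun θ => starRingEnd ℂ (c θ) * Complex.exp (Complex.I * (-(t * h θ) : ℝ)))
      (fun θ => -h θ) := by
  refine ⟨hc.1.neg, ?_⟩
  have h1 : Integrable (fun θ => starRingEnd ℂ (c θ * ((1 + h θ ^ 2)⁻¹ : ℝ))) :=
    (Complex.conjCLE : ℂ →L[ℝ] ℂ).integrable_comp hc.2
  refine (h1.mul_bdd (g := fun θ => Complex.exp (Complex.I * (-(t * h θ) : ℝ))) (c := 1)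
    ?_ ?_).congr (Eventually.of_forall fun θ => ?_)
  · exact (Complex.measurable_exp.comp ((Complex.measurable_ofReal.comp
      (hc.1.const_mul t).neg).const_mul Complex.I)).aestronglyMeasurable
  · exact Eventually.of_forall fun θ => (norm_exp_I_mul_ofReal _).le
  · simp only [map_mul, Complex.conj_ofReal, neg_sq]
    ring

/-- The class of oscillatory distributions is stable: translation multiplies the amplitude by `exp(i
t h)`, conjugation conjugates the amplitude and reverses the frequency. -/
theorem oscDistr_translate_conj {c : E → ℂ} {h : E → ℝ} (hc : OscIntegrable c h) (t : ℝ) :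
    ((oscDistr c h hc).translate t).conj = oscDistr _ _ (hc.conj_translate t) := by
  ext ψ
  rw [Distr.conj_translate_apply, oscDistr_apply, oscDistr_apply, ← integral_conj]
  congr 1
  ext θ
  rw [waveFT_shift, map_mul, map_mul, conj_waveFT, ← Complex.exp_conj, map_mul, Complex.conj_I,
    Complex.conj_ofReal]
  push_cast
  ring_nf

end LocalFourier

/-! ### The product of oscillatory distributions -/

/-- The transform of a square as a convolution. -/
theorem integral_waveFT_mul_waveFT {f : ℝ → ℝ} (hf : ContDiff ℝ ∞ f) (hc : HasCompactSupport f)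
    (α β : ℝ) : ∫ l : ℝ, waveFT f (α - l) * waveFT f (β + l) =
      (2 * Real.pi : ℝ) * waveFT (fun s => f s * f s) (α + β) := by
  have hu : ∀ a : ℝ, ∃ u : SchwartzMap ℝ ℂ,
      ∀ s, u s = (f s : ℂ) * Complex.exp (Complex.I * (s * a : ℝ)) := fun a =>
    ⟨HasCompactSupport.toSchwartzMap
      (f := fun s => (f s : ℂ) * Complex.exp (Complex.I * (s * a : ℝ)))
      (hc.comp_left (g := fun r : ℝ => (r : ℂ)) Complex.ofReal_zero).mul_right
      ((Complex.ofRealCLM.contDiff.comp hf).mul (Complex.contDiff_exp.comp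
        (contDiff_const.mul (Complex.ofRealCLM.contDiff.comp (contDiff_id.mul contDiff_const))))),
      fun s => rfl⟩
  obtain ⟨u, hu1⟩ := hu α
  obtain ⟨v, hv1⟩ := hu β
  have hpi := Real.pi_pos
  -- With `u = f e^{iαs}` and `v = f e^{iβs}`, moving the transform from one factor to the other
  -- turns `∫ 𝓕u · 𝓕⁻¹v` into `∫ u v`. The factor `2π` comes from rescaling the frequency.
  have key := SchwartzMap.integral_fourier_mul_eq u (𝓕⁻ v)
  rw [FourierTransform.fourier_fourierInv_eq] at key
  have h1 : ∀ w : ℝ, (𝓕 u) w = waveFT f (α - (2 * Real.pi) * w) := by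
    intro w
    rw [SchwartzMap.fourier_coe, Real.fourier_eq', waveFT]
    congr 1
    ext s
    rw [hu1, smul_eq_mul, mul_comm, mul_assoc, ← Complex.exp_add]
    congr 2
    simp only [RCLike.inner_apply, conj_trivial]
    push_cast
    ring
  have h2 : ∀ w : ℝ, (𝓕⁻ v) w = waveFT f (β + (2 * Real.pi) * w) := by
    intro w
    rw [SchwartzMap.fourierInv_coe, Real.fourierInv_eq', waveFT]
    congr 1
    ext s
    rw [hv1, smul_eq_mul, mul_comm, mul_assoc, ← Complex.exp_add]
    congr 2
    simp only [RCLike.inner_apply, conj_trivial]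
    push_cast
    ring
  simp only [h1, h2] at key
  have h3 := Measure.integral_comp_mul_left
    (fun l : ℝ => waveFT f (α - l) * waveFT f (β + l)) (2 * Real.pi)
  rw [h3, abs_of_pos (by positivity)] at key
  have h4 : ∫ s, u s * v s = waveFT (fun s => f s * f s) (α + β) := by
    rw [waveFT]
    congr 1
    ext s
    rw [hu1, hv1, mul_add, Complex.ofReal_add, mul_add, Complex.exp_add]
    push_cast
    ring
  rw [h4] at key
  rw [← key, Complex.real_smul, ← mul_assoc, ← Complex.ofReal_mul,
    mul_inv_cancel₀ (by positivity), Complex.ofReal_one, one_mul]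

theorem one_add_sq_add_le (a b : ℝ) : 1 + (a + b) ^ 2 ≤ 2 * ((1 + a ^ 2) * (1 + b ^ 2)) := by
  nlinarith [sq_nonneg (a - b), mul_nonneg (sq_nonneg a) (sq_nonneg b)]

/-- Two transforms at arguments with fixed sum. -/
theorem exists_norm_waveFT_mul_le {f : ℝ → ℝ} (hf : ContDiff ℝ ∞ f) (hc : HasCompactSupport f) :
    ∃ C : ℝ, 0 ≤ C ∧ ∀ a b : ℝ,
      ‖waveFT f a * waveFT f b‖ ≤ C * (1 + (a + b) ^ 2)⁻¹ * (1 + a ^ 2)⁻¹ := by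
  -- Order 4 gives two factors `(1 + a²)⁻¹` and two `(1 + b²)⁻¹`. One of each pays for decay in `a +
  -- b`, the second in `a` is kept for integrability, and the second in `b` is discarded.
  obtain ⟨C, hC, h⟩ := exists_waveFT_decay hf hc 4
  have h' : ∀ a, ‖waveFT f a‖ ≤ C * ((1 + a ^ 2)⁻¹ * (1 + a ^ 2)⁻¹) := by
    intro a
    have h1 : (1 + a ^ 2) * (1 + a ^ 2) ≤ (1 + |a|) ^ 4 := by
      have : 1 + a ^ 2 ≤ (1 + |a|) ^ 2 := by nlinarith [sq_abs a, abs_nonneg a]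
      nlinarith [sq_nonneg a]
    rw [← mul_inv, ← div_eq_mul_inv, le_div_iff₀ (by positivity), mul_comm]
    exact (mul_le_mul_of_nonneg_right h1 (norm_nonneg _)).trans (h a)
  refine ⟨2 * (C * C), by positivity, fun a b => ?_⟩
  have hA : (0 : ℝ) < 1 + a ^ 2 := by positivity
  have hB : (1 : ℝ) ≤ 1 + b ^ 2 := by nlinarith [sq_nonneg b]
  have h3 : (1 + a ^ 2)⁻¹ * (1 + b ^ 2)⁻¹ ≤ 2 * (1 + (a + b) ^ 2)⁻¹ := by
    rw [← mul_inv, ← div_eq_mul_inv, le_div_iff₀ (by positivity), inv_mul_le_iff₀ (by positivity)]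
    linarith [one_add_sq_add_le a b]
  have h4 : (1 + b ^ 2)⁻¹ ≤ 1 := inv_le_one_of_one_le₀ hB
  rw [norm_mul]
  calc ‖waveFT f a‖ * ‖waveFT f b‖
      ≤ (C * ((1 + a ^ 2)⁻¹ * (1 + a ^ 2)⁻¹)) * (C * ((1 + b ^ 2)⁻¹ * (1 + b ^ 2)⁻¹)) := by
        gcongr
        · exact h' a
        · exact h' b
    _ = (C * C) * ((1 + a ^ 2)⁻¹ * (1 + b ^ 2)⁻¹) * (1 + a ^ 2)⁻¹ * (1 + b ^ 2)⁻¹ := by ring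
    _ ≤ (C * C) * (2 * (1 + (a + b) ^ 2)⁻¹) * (1 + a ^ 2)⁻¹ * 1 := by gcongr
    _ = _ := by ring

section Product

variable {E₁ E₂ : Type} [MeasureSpace E₁] [MeasureSpace E₂] [SFinite (volume : Measure E₁)]
  [SFinite (volume : Measure E₂)]

theorem OscIntegrable.aestronglyMeasurable {E : Type} [MeasureSpace E] {c : E → ℂ} {h : E → ℝ}
    (hc : OscIntegrable c h) : AEStronglyMeasurable c := by
  have h1 : AEStronglyMeasurable (fun θ => ((1 + h θ ^ 2 : ℝ) : ℂ)) :=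
    (Complex.measurable_ofReal.comp ((hc.1.pow_const 2).const_add 1)).aestronglyMeasurable
  refine (hc.2.1.mul h1).congr (Eventually.of_forall fun θ => ?_)
  have : (0:ℝ) < 1 + h θ ^ 2 := by positivity
  simp only [Pi.mul_apply]
  rw [mul_assoc, ← Complex.ofReal_mul, inv_mul_cancel₀ this.ne', Complex.ofReal_one, mul_one]

/-- The product of the local transforms is an integral over `E₁ × E₂` of `c₁ c₂ f̂(h₁ - l) f̂(h₂ - k
+ l)`. Integrating in `l` gives `2π` times the transform of `f²` at `h₁ + h₂ - k`. The interchange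
only needs `c₁ c₂` to be integrable against decay in `h₁ + h₂`; no condition on wave front sets
enters. -/
theorem isFourierProduct_oscDistr {c₁ : E₁ → ℂ} {h₁ : E₁ → ℝ} (hc₁ : OscIntegrable c₁ h₁)
    {c₂ : E₂ → ℂ} {h₂ : E₂ → ℝ} (hc₂ : OscIntegrable c₂ h₂)
    (hc : OscIntegrable (fun p : E₁ × E₂ => c₁ p.1 * c₂ p.2) (fun p => h₁ p.1 + h₂ p.2)) :
    IsFourierProduct (oscDistr c₁ h₁ hc₁) (oscDistr c₂ h₂ hc₂) (oscDistr _ _ hc) := by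
  intro s₀
  let B : ContDiffBump s₀ := ⟨1, 2, one_pos, one_lt_two⟩
  let f : TestFn := ⟨B, B.contDiff, B.hasCompactSupport, fun _ _ => trivial⟩
  refine ⟨f, B.eventuallyEq_one, fun k => ?_⟩
  have hf : ContDiff ℝ ∞ f := f.contDiff
  have hfc : HasCompactSupport f := f.hasCompactSupport
  have hcont : Continuous (waveFT f) := (contDiff_waveFT hf hfc).continuous
  set G : (E₁ × E₂) × ℝ → ℂ := fun q => (c₁ q.1.1 * c₂ q.1.2) *
    (waveFT f (h₁ q.1.1 - q.2) * waveFT f (h₂ q.1.2 - (k - q.2))) with hG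
  have hm1 : Measurable fun q : (E₁ × E₂) × ℝ => h₁ q.1.1 :=
    hc₁.1.comp (measurable_fst.comp measurable_fst)
  have hm2 : Measurable fun q : (E₁ × E₂) × ℝ => h₂ q.1.2 :=
    hc₂.1.comp (measurable_snd.comp measurable_fst)
  have hGm : AEStronglyMeasurable G ((volume : Measure (E₁ × E₂)).prod volume) := by
    refine AEStronglyMeasurable.mul ?_ (Measurable.aestronglyMeasurable ?_)
    · exact hc.aestronglyMeasurable.comp_fst
    · exact (hcont.measurable.comp (hm1.sub measurable_snd)).mul
        (hcont.measurable.comp (hm2.sub (measurable_snd.const_sub k)))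
  obtain ⟨C, hC, hbound⟩ := exists_norm_waveFT_mul_le hf hfc
  -- The two arguments of `f̂` have the sum `h₁ + h₂ - k`, free of `l`. The majorant is thus an
  -- integrable function of `p` times a translate of `(1 + l²)⁻¹`, whose integral is `π` whatever
  -- `p` is.
  have hGb : ∀ p l, ‖G (p, l)‖ ≤ 2 * C * (1 + k ^ 2) *
      ‖c₁ p.1 * c₂ p.2 * ((1 + (h₁ p.1 + h₂ p.2) ^ 2)⁻¹ : ℝ)‖ * (1 + (h₁ p.1 - l) ^ 2)⁻¹ := by
    intro p l
    have h1 := hbound (h₁ p.1 - l) (h₂ p.2 - (k - l))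
    have h2 : (h₁ p.1 - l) + (h₂ p.2 - (k - l)) = h₁ p.1 + h₂ p.2 - k := by ring
    rw [h2] at h1
    have h3 : (1 + (h₁ p.1 + h₂ p.2 - k) ^ 2)⁻¹ ≤
        2 * (1 + k ^ 2) * (1 + (h₁ p.1 + h₂ p.2) ^ 2)⁻¹ := by
      have := one_add_sq_add_le (h₁ p.1 + h₂ p.2 - k) k
      rw [sub_add_cancel] at this
      rw [← div_eq_mul_inv, le_div_iff₀ (by positivity), inv_mul_le_iff₀ (by positivity)]
      linarith
    have h4 : ‖((1 + (h₁ p.1 + h₂ p.2) ^ 2)⁻¹ : ℝ)‖ = (1 + (h₁ p.1 + h₂ p.2) ^ 2)⁻¹ :=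
      Real.norm_of_nonneg (by positivity)
    rw [hG, norm_mul, norm_mul (c₁ p.1 * c₂ p.2), Complex.norm_real, h4]
    calc ‖c₁ p.1 * c₂ p.2‖ * _ ≤ ‖c₁ p.1 * c₂ p.2‖ *
        (C * (2 * (1 + k ^ 2) * (1 + (h₁ p.1 + h₂ p.2) ^ 2)⁻¹) * (1 + (h₁ p.1 - l) ^ 2)⁻¹) := by
          refine mul_le_mul_of_nonneg_left (h1.trans ?_) (norm_nonneg _)
          gcongr
      _ = _ := by ring
  have hInt1 : ∀ a : ℝ, Integrable fun l : ℝ => (1 + (a - l) ^ 2)⁻¹ := fun a =>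
    integrable_inv_one_add_sq.comp_sub_left a
  have hInt2 : ∀ a : ℝ, ∫ l : ℝ, (1 + (a - l) ^ 2)⁻¹ = Real.pi := fun a => by
    rw [integral_sub_left_eq_self (fun l : ℝ => (1 + l ^ 2)⁻¹) volume a,
      integral_univ_inv_one_add_sq]
  have hGi : Integrable G ((volume : Measure (E₁ × E₂)).prod volume) := by
    have hpl : ∀ᵐ p : E₁ × E₂, Integrable fun l => G (p, l) := by
      refine Eventually.of_forall fun p => ?_
      refine Integrable.mono' ((hInt1 (h₁ p.1)).const_mul _) ?_
        (Eventually.of_forall (hGb p))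
      have hl : Continuous fun l : ℝ => waveFT f (h₁ p.1 - l) := hcont.comp (by fun_prop)
      have hr : Continuous fun l : ℝ => waveFT f (h₂ p.2 - (k - l)) := hcont.comp (by fun_prop)
      exact (hl.mul hr).aestronglyMeasurable.const_mul (c₁ p.1 * c₂ p.2)
    refine (integrable_prod_iff hGm).2 ⟨hpl, ?_⟩
    refine Integrable.mono' ((hc.2.norm.const_mul (2 * C * (1 + k ^ 2))).mul_const Real.pi)
      hGm.norm.integral_prod_right' ?_
    filter_upwards [hpl] with p hp
    rw [Real.norm_of_nonneg (integral_nonneg fun _ => norm_nonneg _), ← hInt2 (h₁ p.1),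
      ← integral_const_mul]
    exact integral_mono hp.norm ((hInt1 (h₁ p.1)).const_mul _) (hGb p)
  have hprod : ∀ l, localFourier f (oscDistr c₁ h₁ hc₁) l *
      localFourier f (oscDistr c₂ h₂ hc₂) (k - l) = ∫ p, G (p, l) := by
    intro l
    rw [localFourier_oscDistr, localFourier_oscDistr, ← integral_prod_mul]
    congr 1
    ext p
    simp only [hG]
    ring
  simp only [hprod]
  refine ⟨hGi.integral_prod_right, ?_⟩
  rw [integral_integral_swap (f := fun l p => G (p, l)) hGi.swap, localFourier_oscDistr,
    ← integral_const_mul]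
  congr 1
  ext p
  have h1 : ∀ l, G (p, l) = (c₁ p.1 * c₂ p.2) *
      (waveFT f (h₁ p.1 - l) * waveFT f ((h₂ p.2 - k) + l)) := by
    intro l
    simp only [hG]
    congr 3
    ring
  simp only [h1]
  rw [integral_const_mul, integral_waveFT_mul_waveFT hf hfc, mul_left_comm,
    ← mul_assoc ((1 / (2 * Real.pi) : ℝ) : ℂ), ← Complex.ofReal_mul,
    one_div_mul_cancel (by positivity), Complex.ofReal_one, one_mul]
  congr 1
  rw [add_sub_assoc]
  rfl

end Product

/-! ### Symbols -/

/-- `K` is a symbol of order `-m` on the line. -/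
def IsSymbol (m : ℕ) (K : ℝ → ℂ) : Prop :=
  ContDiff ℝ ∞ K ∧ ∀ n : ℕ, ∃ C : ℝ, 0 ≤ C ∧ ∀ ξ, (1 + |ξ|) ^ (m + n) * ‖iteratedDeriv n K ξ‖ ≤ C

theorem IsSymbol.mul {m₁ m₂ : ℕ} {K L : ℝ → ℂ} (hK : IsSymbol m₁ K) (hL : IsSymbol m₂ L) :
    IsSymbol (m₁ + m₂) (fun ξ => K ξ * L ξ) := by
  refine ⟨hK.1.mul hL.1, fun n => ?_⟩
  choose CK hCK hbK using hK.2
  choose CL hCL hbL using hL.2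
  refine ⟨∑ i ∈ Finset.range (n + 1), (n.choose i : ℝ) * (CK i * CL (n - i)),
    Finset.sum_nonneg fun i _ => mul_nonneg (Nat.cast_nonneg _) (mul_nonneg (hCK _) (hCL _)),
    fun ξ => ?_⟩
  have h := norm_iteratedFDeriv_mul_le (n := n) hK.1 hL.1 ξ (by exact_mod_cast le_top)
  simp only [norm_iteratedFDeriv_eq_norm_iteratedDeriv] at h
  refine (mul_le_mul_of_nonneg_left h (by positivity)).trans ?_
  rw [Finset.mul_sum]
  refine Finset.sum_le_sum fun i hi => ?_
  have hin : i ≤ n := Nat.lt_succ_iff.1 (Finset.mem_range.1 hi)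
  have hpow : (1 + |ξ|) ^ (m₁ + m₂ + n) =
      (1 + |ξ|) ^ (m₁ + i) * (1 + |ξ|) ^ (m₂ + (n - i)) := by
    rw [← pow_add]
    congr 1
    omega
  rw [hpow]
  calc _ = (n.choose i : ℝ) * (((1 + |ξ|) ^ (m₁ + i) * ‖iteratedDeriv i K ξ‖) *
        ((1 + |ξ|) ^ (m₂ + (n - i)) * ‖iteratedDeriv (n - i) L ξ‖)) := by ring
    _ ≤ _ := by
      refine mul_le_mul_of_nonneg_left ?_ (Nat.cast_nonneg _)
      exact mul_le_mul (hbK i ξ) (hbL _ ξ) (by positivity) (hCK i)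

theorem IsSymbol.exists_bound {m : ℕ} {K : ℝ → ℂ} (hK : IsSymbol m K) (n : ℕ) :
    ∃ C : ℝ, 0 ≤ C ∧ ∀ ξ, ‖iteratedDeriv n K ξ‖ ≤ C := by
  obtain ⟨C, hC, h⟩ := hK.2 n
  refine ⟨C, hC, fun ξ => le_trans ?_ (h ξ)⟩
  exact le_mul_of_one_le_left (norm_nonneg _) (one_le_pow₀ (by linarith [abs_nonneg ξ]))

theorem IsSymbol.derivative {m : ℕ} {K : ℝ → ℂ} (hK : IsSymbol m K) : IsSymbol (m + 1) (deriv K) := by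
  refine ⟨(contDiff_infty_iff_deriv.1 hK.1).2, fun n => ?_⟩
  obtain ⟨C, hC, h⟩ := hK.2 (n + 1)
  refine ⟨C, hC, fun ξ => ?_⟩
  rw [← iteratedDeriv_succ', add_assoc, add_comm 1 n]
  exact h ξ

theorem IsSymbol.iterated {m : ℕ} {K : ℝ → ℂ} (hK : IsSymbol m K) (n : ℕ) :
    IsSymbol (m + n) (iteratedDeriv n K) := by
  induction n with
  | zero => simpa using hK
  | succ n ih =>
    rw [iteratedDeriv_succ]
    exact ih.derivative

/-- Peetre's inequality, used to move polynomial weights between a point and its translate. -/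
theorem one_add_abs_le (a b : ℝ) : 1 + |a| ≤ (1 + |a + b|) * (1 + |b|) := by
  have h : |a| ≤ |a + b| + |b| := by
    have := abs_sub (a + b) b
    rwa [add_sub_cancel_right] at this
  nlinarith [abs_nonneg b, abs_nonneg (a + b), mul_nonneg (abs_nonneg (a + b)) (abs_nonneg b)]

/-- A continuous function on the line decaying faster than every power. -/
def RapidlyDecreasing (φ : ℝ → ℂ) : Prop :=
  Continuous φ ∧ ∀ n : ℕ, ∃ C : ℝ, 0 ≤ C ∧ ∀ r, (1 + |r|) ^ n * ‖φ r‖ ≤ C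

theorem le_inv_one_add_sq {A C r : ℝ} (hA : 0 ≤ A) (h : (1 + |r|) ^ 2 * A ≤ C) :
    A ≤ C * (1 + r ^ 2)⁻¹ := by
  rw [← div_eq_mul_inv, le_div_iff₀ (by positivity), mul_comm]
  refine le_trans (mul_le_mul_of_nonneg_right ?_ hA) h
  nlinarith [sq_abs r, abs_nonneg r]

theorem RapidlyDecreasing.integrable {φ : ℝ → ℂ} (hφ : RapidlyDecreasing φ) (n : ℕ) :
    Integrable (fun r => (1 + |r|) ^ n * ‖φ r‖) := by
  obtain ⟨C, hC, h⟩ := hφ.2 (n + 2)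
  refine Integrable.mono' (integrable_inv_one_add_sq.const_mul C) ?_
    (Eventually.of_forall fun r => ?_)
  · have := hφ.1
    exact Continuous.aestronglyMeasurable (by fun_prop)
  · rw [Real.norm_of_nonneg (by positivity)]
    refine le_inv_one_add_sq (by positivity) ?_
    rw [← mul_assoc, ← pow_add, add_comm 2 n]
    exact h r

theorem RapidlyDecreasing.integrable_self {φ : ℝ → ℂ} (hφ : RapidlyDecreasing φ) :
    Integrable φ := by
  have := hφ.integrable 0
  simp only [pow_zero, one_mul] at this
  exact (integrable_norm_iff hφ.1.aestronglyMeasurable).1 this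

theorem rapidlyDecreasing_waveFT {g : ℝ → ℝ} (hg : ContDiff ℝ ∞ g) (hc : HasCompactSupport g) :
    RapidlyDecreasing (waveFT g) :=
  ⟨(contDiff_waveFT hg hc).continuous, exists_waveFT_decay hg hc⟩

theorem integrable_translate_mul {L φ : ℝ → ℂ} (hL : Continuous L) {C : ℝ} (hb : ∀ ξ, ‖L ξ‖ ≤ C)
    (hφ : RapidlyDecreasing φ) (η : ℝ) : Integrable fun r => L (η + r) * φ r :=
  hφ.integrable_self.bdd_mul (hL.comp (continuous_const_add η)).aestronglyMeasurable
    (Eventually.of_forall fun _ => hb _)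

theorem hasDerivAt_integral_translate_mul {L φ : ℝ → ℂ} (hL : ContDiff ℝ ∞ L) {C : ℝ}
    (hb : ∀ ξ, ‖L ξ‖ ≤ C) {C' : ℝ} (hb' : ∀ ξ, ‖deriv L ξ‖ ≤ C') (hφ : RapidlyDecreasing φ)
    (η : ℝ) :
    HasDerivAt (fun η => ∫ r, L (η + r) * φ r) (∫ r, deriv L (η + r) * φ r) η := by
  have hL' := (contDiff_infty_iff_deriv.1 hL).2.continuous
  refine (hasDerivAt_integral_of_dominated_loc_of_deriv_le
    (F' := fun η r => deriv L (η + r) * φ r) (bound := fun r => C' * ‖φ r‖) univ_mem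
    (Eventually.of_forall fun η =>
      (integrable_translate_mul hL.continuous hb hφ η).aestronglyMeasurable)
    (integrable_translate_mul hL.continuous hb hφ η)
    (integrable_translate_mul hL' hb' hφ η).aestronglyMeasurable ?_
    (hφ.integrable_self.norm.const_mul C') ?_).2
  · refine Eventually.of_forall fun r η' _ => ?_
    rw [norm_mul]
    exact mul_le_mul_of_nonneg_right (hb' _) (norm_nonneg _)
  · refine Eventually.of_forall fun r η' _ => ?_
    have h1 : HasDerivAt L (deriv L (η' + r)) (η' + r) :=
      ((contDiff_infty_iff_deriv.1 hL).1 _).hasDerivAt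
    exact (h1.comp_add_const η' r).mul_const (φ r)

theorem IsSymbol.iteratedDeriv_integral_translate {m : ℕ} {K φ : ℝ → ℂ} (hK : IsSymbol m K)
    (hφ : RapidlyDecreasing φ) (n : ℕ) :
    iteratedDeriv n (fun η => ∫ r, K (η + r) * φ r) =
      fun η => ∫ r, iteratedDeriv n K (η + r) * φ r := by
  induction n generalizing K m with
  | zero => simp
  | succ n ih =>
    obtain ⟨C, -, hC⟩ := hK.exists_bound 0
    obtain ⟨C', -, hC'⟩ := hK.exists_bound 1
    rw [iteratedDeriv_zero] at hC
    rw [iteratedDeriv_one] at hC'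
    rw [iteratedDeriv_succ', iteratedDeriv_succ', ← ih hK.derivative]
    congr 1
    ext η
    exact (hasDerivAt_integral_translate_mul hK.1 hC hC' hφ η).deriv

/-- Derivatives fall on `K`. Peetre's inequality then trades the weight at `η` for the weight at `η
+ r` times a power of `1 + |r|`, which the rapid decay of `φ` absorbs. -/
theorem IsSymbol.integral_translate {m : ℕ} {K φ : ℝ → ℂ} (hK : IsSymbol m K)
    (hφ : RapidlyDecreasing φ) : IsSymbol m (fun η => ∫ r, K (η + r) * φ r) := by
  refine ⟨contDiff_of_differentiable_iteratedDeriv fun n _ => ?_, fun n => ?_⟩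
  · rw [hK.iteratedDeriv_integral_translate hφ]
    intro η
    obtain ⟨C, -, hC⟩ := hK.exists_bound n
    obtain ⟨C', -, hC'⟩ := hK.exists_bound (n + 1)
    rw [iteratedDeriv_succ] at hC'
    exact (hasDerivAt_integral_translate_mul (hK.iterated n).1 hC hC' hφ η).differentiableAt
  · obtain ⟨C, hC, h⟩ := hK.2 n
    refine ⟨∫ r, C * ((1 + |r|) ^ (m + n) * ‖φ r‖), integral_nonneg fun r => by positivity,
      fun η => ?_⟩
    rw [hK.iteratedDeriv_integral_translate hφ]
    have h1 : (1 + |η|) ^ (m + n) * ‖∫ r, iteratedDeriv n K (η + r) * φ r‖ =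
        ‖∫ r, ((1 + |η|) ^ (m + n) : ℝ) * (iteratedDeriv n K (η + r) * φ r)‖ := by
      rw [integral_const_mul, norm_mul, Complex.norm_real, Real.norm_of_nonneg (by positivity)]
    rw [h1]
    refine norm_integral_le_of_norm_le ((hφ.integrable _).const_mul C)
      (Eventually.of_forall fun r => ?_)
    rw [norm_mul, norm_mul, Complex.norm_real, Real.norm_of_nonneg (by positivity)]
    have h2 : (1 + |η|) ^ (m + n) ≤ (1 + |η + r|) ^ (m + n) * (1 + |r|) ^ (m + n) := by
      rw [← mul_pow]
      exact pow_le_pow_left₀ (by positivity) (one_add_abs_le η r) _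
    calc _ ≤ ((1 + |η + r|) ^ (m + n) * (1 + |r|) ^ (m + n)) *
          (‖iteratedDeriv n K (η + r)‖ * ‖φ r‖) := by gcongr
      _ = ((1 + |η + r|) ^ (m + n) * ‖iteratedDeriv n K (η + r)‖) *
          ((1 + |r|) ^ (m + n) * ‖φ r‖) := by ring
      _ ≤ _ := mul_le_mul_of_nonneg_right (h _) (by positivity)

/-- The Fourier transform of an integrable symbol is smooth away from the origin. -/
theorem IsSymbol.contDiffAt_fourier {K : ℝ → ℂ} (hK : IsSymbol 2 K) {y : ℝ} (hy : y ≠ 0) :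
    ContDiffAt ℝ ∞ (𝓕 K) y := by
  have hint : ∀ n j : ℕ, j ≤ n → Integrable fun ξ => ‖ξ‖ ^ j * ‖iteratedDeriv n K ξ‖ := by
    intro n j hj
    obtain ⟨C, hC, h⟩ := hK.2 n
    have hcont := hK.1.continuous_iteratedDeriv n (by exact_mod_cast le_top)
    refine Integrable.mono' (integrable_inv_one_add_sq.const_mul C)
      (Continuous.aestronglyMeasurable (by fun_prop)) (Eventually.of_forall fun ξ => ?_)
    rw [Real.norm_of_nonneg (by positivity)]
    refine le_inv_one_add_sq (by positivity) (le_trans ?_ (h ξ))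
    rw [← mul_assoc, pow_add]
    refine mul_le_mul_of_nonneg_right (mul_le_mul_of_nonneg_left ?_ (by positivity))
      (norm_nonneg _)
    rw [Real.norm_eq_abs]
    exact (pow_le_pow_left₀ (abs_nonneg _) (by linarith) j).trans
      (pow_le_pow_right₀ (by linarith [abs_nonneg ξ]) hj)
  have hint' : ∀ n : ℕ, Integrable (iteratedDeriv n K) := by
    intro n
    have := hint n 0 (Nat.zero_le _)
    simp only [pow_zero, one_mul] at this
    exact (integrable_norm_iff (hK.1.continuous_iteratedDeriv n
      (by exact_mod_cast le_top)).aestronglyMeasurable).1 this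
  rw [contDiffAt_infty]
  intro n
  -- The `n`-th derivative of `K` has order `-(2 + n)`, so it stays integrable after multiplication
  -- by `|ξ|^j` with `j ≤ n`, and its transform is `C^n`. That transform is `(2πiy)^n 𝓕K`, and one
  -- may divide when `y ≠ 0`.
  have h1 : ContDiff ℝ n (𝓕 (iteratedDeriv n K)) :=
    Real.contDiff_fourier (N := n) fun j hj => hint n j (by exact_mod_cast hj)
  have h2 := Real.fourier_iteratedDeriv (N := ⊤) (n := n) hK.1 (fun j _ => hint' j) le_top
  have h3 : ContDiffAt ℝ n (fun y : ℝ => ((2 * Real.pi * Complex.I * y) ^ n)⁻¹ *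
      𝓕 (iteratedDeriv n K) y) y := by
    refine ContDiffAt.mul (ContDiffAt.inv ?_ ?_) h1.contDiffAt
    · exact ((contDiff_const.mul Complex.ofRealCLM.contDiff).pow n).contDiffAt
    · simp [Real.pi_ne_zero, hy]
  refine h3.congr_of_eventuallyEq ?_
  filter_upwards [isOpen_ne.mem_nhds hy] with z hz
  have hz : z ≠ 0 := hz
  rw [h2]
  simp only [smul_eq_mul]
  rw [inv_mul_cancel_left₀]
  simp [Real.pi_ne_zero, hz]

theorem IsSymbol.contDiffAt_integral_exp {K : ℝ → ℂ} (hK : IsSymbol 2 K) {θ : ℝ} (hθ : θ ≠ 0) :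
    ContDiffAt ℝ ∞ (fun θ : ℝ => ∫ η, K η * Complex.exp (Complex.I * (η * θ : ℝ))) θ := by
  have h1 : (fun θ : ℝ => ∫ η, K η * Complex.exp (Complex.I * (η * θ : ℝ))) =
      fun θ => 𝓕 K (-(θ / (2 * Real.pi))) := by
    ext θ
    rw [Real.fourier_eq']
    congr 1
    ext η
    have : -2 * Real.pi * inner ℝ η (-(θ / (2 * Real.pi))) = η * θ := by
      simp only [RCLike.inner_apply, conj_trivial]
      field_simp [Real.pi_ne_zero]
    rw [this, smul_eq_mul, mul_comm, mul_comm Complex.I]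
  rw [h1]
  refine ContDiffAt.comp θ (hK.contDiffAt_fourier ?_) ?_
  · simp [Real.pi_ne_zero, hθ]
  · exact (contDiff_id.div_const _).neg.contDiffAt

/-- A smooth function which vanishes for negative and is a multiple of the inverse for large
arguments is a symbol of order `-1`. -/
theorem isSymbol_one_of_eq_inv {b : ℝ → ℂ} (hb : ContDiff ℝ ∞ b) (h0 : ∀ ξ < 0, b ξ = 0) {R : ℝ}
    {A : ℂ} (hA : ∀ ξ, R < ξ → b ξ = A * (ξ : ℂ)⁻¹) : IsSymbol 1 b := by
  refine ⟨hb, fun n => ?_⟩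
  set M := max R 1
  have hcont : Continuous fun ξ : ℝ => (1 + |ξ|) ^ (1 + n) * ‖iteratedDeriv n b ξ‖ := by
    have := hb.continuous_iteratedDeriv n (by exact_mod_cast le_top)
    fun_prop
  obtain ⟨C, hC⟩ := (isCompact_Icc (a := (0 : ℝ)) (b := M)).exists_bound_of_continuousOn
    hcont.continuousOn
  refine ⟨max C (2 ^ (1 + n) * (‖A‖ * n.factorial)), le_max_of_le_right (by positivity),
    fun ξ => ?_⟩
  rcases lt_or_ge ξ 0 with hξ | hξ
  · have : b =ᶠ[𝓝 ξ] fun _ => 0 := by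
      filter_upwards [Iio_mem_nhds hξ] with z hz using h0 z hz
    rw [this.iteratedDeriv_eq]
    rw [iteratedDeriv_const]
    simp only [ite_self, norm_zero, mul_zero]
    exact le_max_of_le_right (by positivity)
  rcases le_or_gt ξ M with hM | hM
  · have := hC ξ ⟨hξ, hM⟩
    rw [Real.norm_of_nonneg (by positivity)] at this
    exact this.trans (le_max_left _ _)
  · refine le_trans ?_ (le_max_right _ _)
    have h1 : 1 < ξ := (le_max_right _ _).trans_lt hM
    have hξ0 : 0 < ξ := by linarith
    have : b =ᶠ[𝓝 ξ] fun ξ => A * (ξ : ℂ)⁻¹ := by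
      filter_upwards [Ioi_mem_nhds hM] with z hz using hA z ((le_max_left _ _).trans_lt hz)
    have hd : ∀ n : ℕ, ∀ z : ℝ, z ≠ 0 → iteratedDeriv n (fun ξ : ℝ => A * (ξ : ℂ)⁻¹) z =
        A * ((-1) ^ n * n.factorial * ((z : ℂ)⁻¹) ^ (n + 1)) := by
      intro n
      induction n with
      | zero => intro z hz; simp
      | succ n ih =>
        intro z hz
        have hz' : (z : ℂ) ≠ 0 := Complex.ofReal_ne_zero.2 hz
        rw [iteratedDeriv_succ]
        have he : iteratedDeriv n (fun ξ : ℝ => A * (ξ : ℂ)⁻¹) =ᶠ[𝓝 z]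
            fun z => A * ((-1) ^ n * n.factorial * ((z : ℂ)⁻¹) ^ (n + 1)) := by
          filter_upwards [isOpen_ne.mem_nhds hz] with y hy using ih y hy
        rw [he.deriv_eq]
        have h2 := ((((hasDerivAt_inv hz').comp_ofReal).pow (n + 1)).const_mul
          ((-1) ^ n * (n.factorial : ℂ))).const_mul A
        refine h2.deriv.trans ?_
        rw [Nat.factorial_succ]
        simp only [Nat.add_sub_cancel, inv_pow]
        push_cast
        field_simp
        ring
    rw [this.iteratedDeriv_eq, hd n ξ hξ0.ne']
    simp only [norm_mul, norm_pow, norm_neg, norm_one, one_pow, one_mul, Complex.norm_natCast,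
      norm_inv, Complex.norm_real, Real.norm_eq_abs, abs_of_pos hξ0]
    have h3 : (1 + ξ) ^ (1 + n) ≤ 2 ^ (1 + n) * ξ ^ (1 + n) := by
      rw [← mul_pow]
      exact pow_le_pow_left₀ (by positivity) (by linarith) _
    calc (1 + ξ) ^ (1 + n) * (‖A‖ * (n.factorial * ξ⁻¹ ^ (n + 1)))
        ≤ (2 ^ (1 + n) * ξ ^ (1 + n)) * (‖A‖ * (n.factorial * ξ⁻¹ ^ (n + 1))) := by gcongr
      _ = _ := by
        rw [inv_pow, add_comm n 1]
        field_simp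

/-! ### Rapid decay off the singular support -/

theorem hasDerivAt_waveFT {g : ℝ → ℝ} (hg : Continuous g) (hc : HasCompactSupport g) (k : ℝ) :
    HasDerivAt (waveFT g) (Complex.I * waveFT (fun s => s * g s) k) k := by
  have hint : ∀ {f : ℝ → ℝ}, Continuous f → HasCompactSupport f → ∀ k : ℝ,
      Integrable fun s : ℝ => (f s : ℂ) * Complex.exp (Complex.I * (s * k : ℝ)) := by
    intro f hf hfc k
    refine Continuous.integrable_of_hasCompactSupport
      ((Complex.continuous_ofReal.comp hf).mul (by fun_prop)) ?_
    exact (hfc.comp_left (g := fun r : ℝ => (r : ℂ)) Complex.ofReal_zero).mul_right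
  have hg' : Continuous fun s => s * g s := continuous_id.mul hg
  have hc' : HasCompactSupport fun s => s * g s := hc.mul_left
  rw [waveFT, ← integral_const_mul]
  refine (hasDerivAt_integral_of_dominated_loc_of_deriv_le (F := fun k s =>
      (g s : ℂ) * Complex.exp (Complex.I * (s * k : ℝ)))
    (F' := fun k s => Complex.I *
      (((s * g s : ℝ) : ℂ) * Complex.exp (Complex.I * (s * k : ℝ))))
    (bound := fun s => ‖s * g s‖) univ_mem
    (Eventually.of_forall fun k => (hint hg hc k).aestronglyMeasurable) (hint hg hc k)
    ((hint hg' hc' k).const_mul _).aestronglyMeasurable ?_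
    (hg'.integrable_of_hasCompactSupport hc').norm ?_).2
  · refine Eventually.of_forall fun s k _ => ?_
    rw [norm_mul, norm_mul, norm_exp_I_mul_ofReal, Complex.norm_I, Complex.norm_real, one_mul,
      mul_one]
  · refine Eventually.of_forall fun s k _ => ?_
    have h1 : HasDerivAt (fun k : ℝ => Complex.I * ((s * k : ℝ) : ℂ)) (Complex.I * (s : ℂ)) k := by
      have := ((hasDerivAt_id k).const_mul s).ofReal_comp.const_mul Complex.I
      simpa using this
    have h2 := h1.cexp.const_mul (g s : ℂ)
    convert! h2 using 1
    push_cast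
    ring

/-- Multiplication by `s` becomes differentiation of the transform up to a factor `i`; integration
by parts then moves the derivative onto the symbol. -/
theorem integral_symbol_mul_waveFT {m : ℕ} {b : ℝ → ℂ} (hb : IsSymbol m b) {g : ℝ → ℝ}
    (hg : ContDiff ℝ ∞ g) (hc : HasCompactSupport g) (k : ℝ) :
    ‖∫ ξ, b ξ * waveFT (fun s => s * g s) (ξ - k)‖ = ‖∫ ξ, deriv b ξ * waveFT g (ξ - k)‖ := by
  have hint : ∀ {m : ℕ} {b : ℝ → ℂ}, IsSymbol m b → ∀ {g : ℝ → ℝ}, ContDiff ℝ ∞ g →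
      HasCompactSupport g → Integrable fun ξ => b ξ * waveFT g (ξ - k) := by
    intro m b hb g hg hc
    obtain ⟨C, -, hC⟩ := hb.exists_bound 0
    rw [iteratedDeriv_zero] at hC
    exact ((rapidlyDecreasing_waveFT hg hc).integrable_self.comp_sub_right k).bdd_mul
      hb.1.continuous.aestronglyMeasurable (Eventually.of_forall hC)
  have hg' : ContDiff ℝ ∞ fun s => s * g s := contDiff_id.mul hg
  have hc' : HasCompactSupport fun s => s * g s := hc.mul_left
  have key := integral_mul_deriv_eq_deriv_mul_of_integrable (u := b)
    (v := fun ξ => waveFT g (ξ - k)) (u' := deriv b)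
    (v' := fun ξ => Complex.I * waveFT (fun s => s * g s) (ξ - k))
    (fun ξ _ => ((contDiff_infty_iff_deriv.1 hb.1).1 ξ).hasDerivAt)
    (fun ξ _ => (hasDerivAt_waveFT hg.continuous hc (ξ - k)).comp_sub_const ξ k)
    (((hint hb hg' hc').const_mul Complex.I).congr (Eventually.of_forall fun ξ => by
      simp only [Pi.mul_apply]; ring))
    (hint hb.derivative hg hc) (hint hb hg hc)
  simp only [mul_left_comm _ Complex.I] at key
  rw [integral_const_mul] at key
  have := congrArg norm key
  rwa [norm_mul, Complex.norm_I, one_mul, norm_neg] at this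

theorem contDiff_div_of_eventually_zero {g : ℝ → ℝ} (hg : ContDiff ℝ ∞ g)
    (h0 : ∀ᶠ s in 𝓝 0, g s = 0) : ContDiff ℝ ∞ fun s => g s / s := by
  rw [contDiff_iff_contDiffAt]
  intro s
  rcases eq_or_ne s 0 with rfl | hs
  · refine (contDiffAt_const (c := (0 : ℝ))).congr_of_eventuallyEq ?_
    filter_upwards [h0] with s hs
    rw [hs, zero_div]
  · exact hg.contDiffAt.div contDiffAt_id hs

/-- Because `g` vanishes near the origin, it can be written as `s` times the smooth function `g /
s`. Each such division lowers the order of the symbol by one; after `n` rounds `L` is the `n`-th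
derivative of `b` and `f = g / s^n`. -/
theorem exists_deriv_symbol {m : ℕ} {b : ℝ → ℂ} (hb : IsSymbol m b) (n : ℕ) {g : ℝ → ℝ}
    (hg : ContDiff ℝ ∞ g) (hc : HasCompactSupport g) (h0 : ∀ᶠ s in 𝓝 0, g s = 0) :
    ∃ (L : ℝ → ℂ) (f : ℝ → ℝ), IsSymbol (m + n) L ∧ ContDiff ℝ ∞ f ∧ HasCompactSupport f ∧
      ∀ k, ‖∫ ξ, b ξ * waveFT g (ξ - k)‖ = ‖∫ ξ, L ξ * waveFT f (ξ - k)‖ := by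
  induction n generalizing m b g with
  | zero => exact ⟨b, g, hb, hg, hc, fun _ => rfl⟩
  | succ n ih =>
    have hg' := contDiff_div_of_eventually_zero hg h0
    have hc' : HasCompactSupport fun s => g s / s := by
      simp only [div_eq_mul_inv]
      exact hc.mul_right
    obtain ⟨L, f, hL, hf, hfc, h⟩ := ih hb.derivative hg' hc' (by
      filter_upwards [h0] with s hs
      rw [hs, zero_div])
    refine ⟨L, f, by rwa [add_assoc, add_comm 1 n] at hL, hf, hfc, fun k => ?_⟩
    rw [← h k, ← integral_symbol_mul_waveFT hb hg' hc']
    congr! 5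
    ext s
    rcases eq_or_ne s 0 with rfl | hs
    · rw [h0.self_of_nhds, zero_mul]
    · field_simp

/-- The convolution of a symbol with the transform of a function vanishing near the origin decays
rapidly. -/
theorem IsSymbol.exists_integral_waveFT_decay {m : ℕ} {b : ℝ → ℂ} (hb : IsSymbol m b) {g : ℝ → ℝ}
    (hg : ContDiff ℝ ∞ g) (hc : HasCompactSupport g) (h0 : ∀ᶠ s in 𝓝 0, g s = 0) (N : ℕ) :
    ∃ C : ℝ, ∀ k, ‖∫ ξ, b ξ * waveFT g (ξ - k)‖ * (1 + |k|) ^ N ≤ C := by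
  -- After `N` rounds `(1 + |ξ|)^N L(ξ)` is bounded, and Peetre's inequality splits `(1 + |k|)^N`
  -- between `L` at `ξ` and `f̂` at `ξ - k`.
  obtain ⟨L, f, hL, hf, hfc, h⟩ := exists_deriv_symbol hb N hg hc h0
  obtain ⟨A, hA, hLA⟩ := hL.2 0
  simp only [add_zero, iteratedDeriv_zero] at hLA
  have hφ := rapidlyDecreasing_waveFT hf hfc
  refine ⟨∫ r, A * ((1 + |r|) ^ N * ‖waveFT f r‖), fun k => ?_⟩
  rw [h k, ← integral_sub_right_eq_self (fun r => A * ((1 + |r|) ^ N * ‖waveFT f r‖)) k]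
  have h1 : ‖∫ ξ, L ξ * waveFT f (ξ - k)‖ * (1 + |k|) ^ N =
      ‖∫ ξ, ((1 + |k|) ^ N : ℝ) * (L ξ * waveFT f (ξ - k))‖ := by
    rw [integral_const_mul, norm_mul, Complex.norm_real, Real.norm_of_nonneg (by positivity),
      mul_comm]
  rw [h1]
  refine norm_integral_le_of_norm_le (((hφ.integrable N).const_mul A).comp_sub_right k)
    (Eventually.of_forall fun ξ => ?_)
  rw [norm_mul, norm_mul, Complex.norm_real, Real.norm_of_nonneg (by positivity)]
  have h2 : (1 + |k|) ^ N ≤ (1 + |ξ|) ^ N * (1 + |ξ - k|) ^ N := by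
    rw [← mul_pow]
    have := one_add_abs_le k (ξ - k)
    rw [add_sub_cancel] at this
    exact pow_le_pow_left₀ (by positivity) this _
  have h3 : (1 + |ξ|) ^ N * ‖L ξ‖ ≤ A := by
    refine le_trans (mul_le_mul_of_nonneg_right ?_ (norm_nonneg _)) (hLA ξ)
    exact pow_le_pow_right₀ (by linarith [abs_nonneg ξ]) (Nat.le_add_left _ _)
  calc _ ≤ ((1 + |ξ|) ^ N * (1 + |ξ - k|) ^ N) * (‖L ξ‖ * ‖waveFT f (ξ - k)‖) := by gcongr
    _ = ((1 + |ξ|) ^ N * ‖L ξ‖) * ((1 + |ξ - k|) ^ N * ‖waveFT f (ξ - k)‖) := by ring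
    _ ≤ _ := mul_le_mul_of_nonneg_right h3 (by positivity)

/-! ### The amplitudes of the factors -/

/-- A smooth even high-frequency cut-off. -/
structure IsHighCutoff (χ : ℝ → ℝ) : Prop where
  smooth : ContDiff ℝ ∞ χ
  even : ∀ ξ, χ (-ξ) = χ ξ
  zero : ∀ᶠ ξ in 𝓝 0, χ ξ = 0
  one : ∀ ξ, 1 ≤ |ξ| → χ ξ = 1

/-- The part of `waveAmp χ γ` on the positive half-line. -/
def halfAmp (χ : ℝ → ℝ) (γ ξ : ℝ) : ℝ := if 0 < ξ then χ (ξ / γ) / (γ * ξ) else 0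

section Amplitude

variable {χ : ℝ → ℝ} {γ : ℝ}

theorem halfAmp_of_pos {ξ : ℝ} (h : 0 < ξ) : halfAmp χ γ ξ = χ (ξ / γ) / (γ * ξ) := if_pos h

theorem halfAmp_of_nonpos {ξ : ℝ} (h : ξ ≤ 0) : halfAmp χ γ ξ = 0 := if_neg h.not_gt

theorem IsHighCutoff.eventually_div (hχ : IsHighCutoff χ) : ∀ᶠ ξ in 𝓝 0, χ (ξ / γ) = 0 := by
  have : Tendsto (fun ξ : ℝ => ξ / γ) (𝓝 0) (𝓝 0) := by
    have := (continuous_id.div_const γ).tendsto (0 : ℝ)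
    simpa using this
  exact this.eventually hχ.zero

theorem contDiff_halfAmp (hχ : IsHighCutoff χ) (hγ : 0 < γ) : ContDiff ℝ ∞ (halfAmp χ γ) := by
  rw [contDiff_iff_contDiffAt]
  intro ξ
  rcases lt_trichotomy ξ 0 with h | rfl | h
  · refine (contDiffAt_const (c := (0 : ℝ))).congr_of_eventuallyEq ?_
    filter_upwards [Iio_mem_nhds h] with z hz using halfAmp_of_nonpos (le_of_lt hz)
  · refine (contDiffAt_const (c := (0 : ℝ))).congr_of_eventuallyEq ?_
    filter_upwards [hχ.eventually_div (γ := γ)] with z hz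
    rw [halfAmp, hz, zero_div, ite_self]
  · have h1 : ContDiffAt ℝ ∞ (fun ξ => χ (ξ / γ) / (γ * ξ)) ξ :=
      (hχ.smooth.comp (contDiff_id.div_const γ)).contDiffAt.div
        (contDiff_const.mul contDiff_id).contDiffAt (mul_pos hγ h).ne'
    refine h1.congr_of_eventuallyEq ?_
    filter_upwards [Ioi_mem_nhds h] with z hz using halfAmp_of_pos hz

/-- Evenness of `χ` identifies the two half-lines. On each of them `|ξ|` is linear, so the phase is
linear too and symbol calculus applies. -/
theorem waveAmp_eq_halfAmp (hχ : IsHighCutoff χ) (ξ : ℝ) :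
    waveAmp χ γ ξ = halfAmp χ γ ξ + halfAmp χ γ (-ξ) := by
  rw [waveAmp]
  rcases lt_trichotomy ξ 0 with h | rfl | h
  · rw [halfAmp_of_nonpos h.le, halfAmp_of_pos (neg_pos.2 h), abs_of_neg h, neg_div, hχ.even,
      zero_add]
  · rw [neg_zero, halfAmp_of_nonpos le_rfl, abs_zero, mul_zero, div_zero, add_zero]
  · rw [halfAmp_of_pos h, halfAmp_of_nonpos (by linarith), abs_of_pos h, add_zero]

theorem contDiff_waveAmp (hχ : IsHighCutoff χ) (hγ : 0 < γ) : ContDiff ℝ ∞ (waveAmp χ γ) := by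
  rw [funext (waveAmp_eq_halfAmp (γ := γ) hχ)]
  exact (contDiff_halfAmp hχ hγ).add ((contDiff_halfAmp hχ hγ).comp contDiff_neg)

theorem waveAmp_eventually_zero (hχ : IsHighCutoff χ) : ∀ᶠ ξ in 𝓝 0, waveAmp χ γ ξ = 0 := by
  filter_upwards [hχ.eventually_div (γ := γ)] with z hz
  rw [waveAmp, hz, zero_div]

theorem isSymbol_halfAmp (hχ : IsHighCutoff χ) (hγ : 0 < γ) :
    IsSymbol 1 (fun ξ => (halfAmp χ γ ξ : ℂ)) := by
  refine isSymbol_one_of_eq_inv (R := γ) (A := ((γ⁻¹ : ℝ) : ℂ))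
    (Complex.ofRealCLM.contDiff.comp (contDiff_halfAmp hχ hγ)) ?_ ?_
  · intro ξ hξ
    rw [halfAmp_of_nonpos hξ.le, Complex.ofReal_zero]
  · intro ξ hξ
    have h1 : χ (ξ / γ) = 1 := by
      refine hχ.one _ (le_trans ?_ (le_abs_self _))
      rw [le_div_iff₀ hγ, one_mul]
      exact hξ.le
    rw [halfAmp_of_pos (hγ.trans hξ), h1, one_div, mul_inv]
    push_cast
    ring

theorem exists_halfAmp_bound (hχ : IsHighCutoff χ) (hγ : 0 < γ) :
    ∃ C : ℝ, 0 ≤ C ∧ ∀ ξ, (1 + |ξ|) * |halfAmp χ γ ξ| ≤ C := by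
  obtain ⟨C, hC, h⟩ := (isSymbol_halfAmp hχ hγ).2 0
  refine ⟨C, hC, fun ξ => ?_⟩
  have := h ξ
  rwa [iteratedDeriv_zero, add_zero, pow_one, Complex.norm_real] at this

theorem exists_waveAmp_bound (hχ : IsHighCutoff χ) (hγ : 0 < γ) :
    ∃ C : ℝ, 0 ≤ C ∧ ∀ ξ, (1 + |ξ|) * |waveAmp χ γ ξ| ≤ C := by
  obtain ⟨C, hC, h⟩ := exists_halfAmp_bound hχ hγ
  refine ⟨C + C, by positivity, fun ξ => ?_⟩
  have h2 := h (-ξ)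
  rw [abs_neg] at h2
  rw [waveAmp_eq_halfAmp hχ]
  have := abs_add_le (halfAmp χ γ ξ) (halfAmp χ γ (-ξ))
  have h3 := mul_le_mul_of_nonneg_left this (by positivity : 0 ≤ 1 + |ξ|)
  linarith [h ξ]

/-! ### The factors -/

theorem oscIntegrable_abs_of_bound {b : ℝ → ℝ} (hb : Continuous b) {C : ℝ}
    (h : ∀ ξ, (1 + |ξ|) * |b ξ| ≤ C) (y : ℝ) :
    OscIntegrable (fun ξ : ℝ => (b ξ : ℂ) * Complex.exp (Complex.I * (-(y * ξ) : ℝ)))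
      (fun ξ => |ξ|) := by
  refine ⟨measurable_id.abs, ?_⟩
  refine Integrable.mono' (integrable_inv_one_add_sq.const_mul C)
    (Continuous.aestronglyMeasurable ?_) (Eventually.of_forall fun ξ => ?_)
  · have h1 : ∀ ξ : ℝ, 1 + |ξ| ^ 2 ≠ 0 := fun ξ => by positivity
    exact ((Complex.continuous_ofReal.comp hb).mul (continuous_exp_I_mul (by fun_prop))).mul
      (Complex.continuous_ofReal.comp (Continuous.inv₀ (by fun_prop) h1))
  · rw [norm_mul, norm_mul, norm_exp_I_mul_ofReal, Complex.norm_real, Complex.norm_real, mul_one,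
      Real.norm_eq_abs, Real.norm_of_nonneg (by positivity), sq_abs]
    refine mul_le_mul_of_nonneg_right ?_ (by positivity)
    exact (le_mul_of_one_le_left (abs_nonneg _) (by linarith [abs_nonneg ξ])).trans (h ξ)

theorem oscIntegrable_waveAmp (hχ : IsHighCutoff χ) (hγ : 0 < γ) (y : ℝ) :
    OscIntegrable (fun ξ : ℝ => (waveAmp χ γ ξ : ℂ) * Complex.exp (Complex.I * (-(y * ξ) : ℝ)))
      (fun ξ => |ξ|) := by
  obtain ⟨C, -, h⟩ := exists_waveAmp_bound hχ hγ
  exact oscIntegrable_abs_of_bound (contDiff_waveAmp hχ hγ).continuous h y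

/-- The oscillatory integral `∫ exp(i (s|ξ| - y ξ)) χ(ξ / γ) / (γ |ξ|) dξ`. -/
def waveDistr (hχ : IsHighCutoff χ) (hγ : 0 < γ) (y : ℝ) : Distr :=
  oscDistr _ _ (oscIntegrable_waveAmp hχ hγ y)

theorem notMem_tsupport_of_eventually_zero {X : Type*} [TopologicalSpace X] {a : X → ℝ} {p : X}
    (h : ∀ᶠ z in 𝓝 p, a z = 0) : p ∉ tsupport a := by
  rw [notMem_tsupport_iff_eventuallyEq]
  exact h

theorem fderiv_ne_zero_of_deriv_comp {X : Type*} [NormedAddCommGroup X] [NormedSpace ℝ X]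
    {F : X → ℝ} {p v : X} (hF : DifferentiableAt ℝ F p) {d : ℝ}
    (hd : HasDerivAt (fun ε : ℝ => F (p + ε • v)) d 0) (h0 : d ≠ 0) : fderiv ℝ F p ≠ 0 := by
  intro h
  refine h0 ?_
  have h1 : HasDerivAt (fun ε : ℝ => p + ε • v) v 0 := by
    simpa using ((hasDerivAt_id (0 : ℝ)).smul_const v).const_add p
  have h2 : HasFDerivAt F (fderiv ℝ F p) (p + (0 : ℝ) • v) := by
    rw [zero_smul, add_zero]
    exact hF.hasFDerivAt
  have h3 := h2.comp_hasDerivAt (0 : ℝ) h1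
  rw [h] at h3
  exact hd.unique h3

theorem isOscInt_waveDistr (hχ : IsHighCutoff χ) (hγ : 0 < γ) (y : ℝ) :
    IsOscInt (wavePhase y) (waveAmp χ γ) (waveDistr hχ hγ y) := by
  refine ⟨contDiff_waveAmp hχ hγ, ?_, ?_⟩
  · intro s ξ hξ
    have hξ0 : ξ ≠ 0 := by
      rintro rfl
      exact notMem_tsupport_of_eventually_zero (waveAmp_eventually_zero hχ) hξ
    have hsm : ContDiffAt ℝ ∞ (fun p : ℝ × ℝ => wavePhase y p.1 p.2) (s, ξ) := by
      refine (contDiffAt_fst.mul (ContDiffAt.abs contDiffAt_snd hξ0)).sub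
        (contDiffAt_const.mul contDiffAt_snd)
    refine ⟨fun r hr => ?_, hsm, ?_⟩
    · simp only [wavePhase, smul_eq_mul, abs_mul, abs_of_pos hr]
      ring
    -- The `s`-derivative of the phase is `|ξ|`, which is nonzero on the support of the amplitude.
    · refine fderiv_ne_zero_of_deriv_comp (v := (1, 0)) (d := |ξ|)
        (hsm.differentiableAt (by simp)) ?_ (abs_ne_zero.2 hξ0)
      have h1 : (fun ε : ℝ => wavePhase y ((s, ξ) + ε • ((1 : ℝ), (0 : ℝ))).1
          ((s, ξ) + ε • ((1 : ℝ), (0 : ℝ))).2) = fun ε => (s + ε) * |ξ| - y * ξ := by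
        ext ε
        simp [wavePhase]
      rw [h1]
      simpa using (((hasDerivAt_id (0 : ℝ)).const_add s).mul_const |ξ|).sub_const (y * ξ)
  · refine isCutoffLimit_oscDistr (contDiff_waveAmp hχ hγ).continuous continuous_abs
      (g := fun ξ => -(y * ξ)) (by fun_prop) (fun s ξ => ?_) _
    rw [wavePhase]
    ring

/-! ### Wave front sets of the factors -/

theorem waveFT_comp_add (f : ℝ → ℝ) (y k : ℝ) :
    waveFT (fun s => f (s + y)) k = Complex.exp (Complex.I * (-(y * k) : ℝ)) * waveFT f k := by
  rw [waveFT, waveFT, ← integral_const_mul,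
    ← integral_add_right_eq_self (fun s => Complex.exp (Complex.I * (-(y * k) : ℝ)) *
      ((f s : ℂ) * Complex.exp (Complex.I * (s * k : ℝ)))) y]
  congr 1
  ext s
  rw [mul_left_comm, ← Complex.exp_add]
  congr 2
  push_cast
  ring

/-- Writing `exp(-iyξ) = exp(-iyk) exp(-iy(ξ - k))` shows that the phase merely translates `f` by
`y`. This reduces the claim to a cut-off vanishing near the origin. -/
theorem exists_halfAmp_integral_decay (hχ : IsHighCutoff χ) (hγ : 0 < γ) (y : ℝ) (f : TestFn)
    (h0 : ∀ᶠ s in 𝓝 y, f s = 0) (N : ℕ) : ∃ C : ℝ, ∀ k : ℝ,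
      ‖∫ ξ : ℝ, (halfAmp χ γ ξ : ℂ) * (Complex.exp (Complex.I * (-(y * ξ) : ℝ)) *
        waveFT f (ξ - k))‖ * (1 + |k|) ^ N ≤ C := by
  have hg : ContDiff ℝ ∞ fun s => f (s + y) := f.contDiff.comp (contDiff_id.add contDiff_const)
  have hc : HasCompactSupport fun s => f (s + y) :=
    f.hasCompactSupport.comp_homeomorph (Homeomorph.addRight y)
  have hz : ∀ᶠ s in 𝓝 0, f (s + y) = 0 := by
    have : Tendsto (fun s : ℝ => s + y) (𝓝 0) (𝓝 y) := by
      have := (continuous_add_const y).tendsto (0 : ℝ)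
      rwa [zero_add] at this
    exact this.eventually h0
  obtain ⟨C, hC⟩ := (isSymbol_halfAmp hχ hγ).exists_integral_waveFT_decay hg hc hz N
  refine ⟨C, fun k => le_trans (le_of_eq ?_) (hC k)⟩
  congr 1
  have h1 : (∫ ξ : ℝ, (halfAmp χ γ ξ : ℂ) * (Complex.exp (Complex.I * (-(y * ξ) : ℝ)) *
        waveFT f (ξ - k))) = Complex.exp (Complex.I * (-(y * k) : ℝ)) *
      ∫ ξ : ℝ, (halfAmp χ γ ξ : ℂ) * waveFT (fun s => f (s + y)) (ξ - k) := by
    rw [← integral_const_mul]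
    congr 1
    ext ξ
    have he : Complex.exp (Complex.I * (-(y * ξ) : ℝ)) =
        Complex.exp (Complex.I * (-(y * k) : ℝ)) *
          Complex.exp (Complex.I * (-(y * (ξ - k)) : ℝ)) := by
      rw [← Complex.exp_add]
      congr 1
      push_cast
      ring
    rw [waveFT_comp_add, he]
    ring
  rw [h1, norm_mul, norm_exp_I_mul_ofReal, one_mul]

theorem integrable_mul_waveFT_sub {E : Type} [MeasureSpace E] {c : E → ℂ} {h : E → ℝ}
    (hc : OscIntegrable c h) {g : ℝ → ℝ} (hg : ContDiff ℝ ∞ g) (hs : HasCompactSupport g) (k : ℝ) :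
    Integrable (fun θ => c θ * waveFT g (h θ - k)) := by
  refine integrable_mul_of_decay hc (C := 2 * (1 + k ^ 2) *
      ((∫ s, ‖g s‖) + ∫ s, ‖iteratedFDeriv ℝ 2 g s‖)) ?_ fun θ => ?_
  · exact ((contDiff_waveFT hg hs).continuous.measurable.comp
      (hc.1.sub_const k)).aestronglyMeasurable
  · have h1 := one_add_sq_add_le (h θ - k) k
    rw [sub_add_cancel] at h1
    calc _ ≤ 2 * ((1 + (h θ - k) ^ 2) * (1 + k ^ 2)) * ‖waveFT g (h θ - k)‖ := by gcongr
      _ = 2 * (1 + k ^ 2) * ((1 + (h θ - k) ^ 2) * ‖waveFT g (h θ - k)‖) := by ring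
      _ ≤ _ := by
        gcongr
        exact waveFT_norm_le g hg hs _

/-- Reflecting the negative half-line replaces `y` by `-y`. The two terms are the sources of the
singularities at `s = y` and `s = -y`. -/
theorem localFourier_waveDistr (hχ : IsHighCutoff χ) (hγ : 0 < γ) (y : ℝ) (f : TestFn) (k : ℝ) :
    localFourier f (waveDistr hχ hγ y) k =
      (∫ ξ : ℝ, (halfAmp χ γ ξ : ℂ) * (Complex.exp (Complex.I * (-(y * ξ) : ℝ)) *
        waveFT f (ξ - k))) +
      ∫ ξ : ℝ, (halfAmp χ γ ξ : ℂ) * (Complex.exp (Complex.I * (-(-y * ξ) : ℝ)) *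
        waveFT f (ξ - k)) := by
  obtain ⟨C, -, h⟩ := exists_halfAmp_bound hχ hγ
  have hcont := (contDiff_halfAmp hχ hγ).continuous
  have hint : ∀ y : ℝ, Integrable fun ξ : ℝ =>
      (halfAmp χ γ ξ : ℂ) * Complex.exp (Complex.I * (-(y * ξ) : ℝ)) * waveFT f (|ξ| - k) :=
    fun y => integrable_mul_waveFT_sub (oscIntegrable_abs_of_bound hcont h y) f.contDiff
      f.hasCompactSupport k
  have habs : ∀ y ξ : ℝ, (halfAmp χ γ ξ : ℂ) *
      (Complex.exp (Complex.I * (-(y * ξ) : ℝ)) * waveFT f (ξ - k)) =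
      (halfAmp χ γ ξ : ℂ) * Complex.exp (Complex.I * (-(y * ξ) : ℝ)) * waveFT f (|ξ| - k) := by
    intro y ξ
    rcases le_or_gt ξ 0 with h | h
    · rw [halfAmp_of_nonpos h]
      simp
    · rw [abs_of_pos h, mul_assoc]
  simp only [habs]
  rw [waveDistr, localFourier_oscDistr, ← integral_neg_eq_self (fun ξ : ℝ =>
    (halfAmp χ γ ξ : ℂ) * Complex.exp (Complex.I * (-(-y * ξ) : ℝ)) * waveFT f (|ξ| - k)),
    ← integral_add (hint y)]
  · congr 1
    ext ξ
    rw [waveAmp_eq_halfAmp hχ, abs_neg, neg_mul_neg, Complex.ofReal_add]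
    ring
  · exact (hint (-y)).comp_neg

theorem exists_localFourier_waveDistr_decay (hχ : IsHighCutoff χ) (hγ : 0 < γ) {y : ℝ}
    {f : TestFn} (h1 : ∀ᶠ s in 𝓝 y, f s = 0) (h2 : ∀ᶠ s in 𝓝 (-y), f s = 0) (N : ℕ) :
    ∃ C : ℝ, ∀ k : ℝ, ‖localFourier f (waveDistr hχ hγ y) k‖ * (1 + |k|) ^ N ≤ C := by
  obtain ⟨C₁, hC₁⟩ := exists_halfAmp_integral_decay hχ hγ y f h1 N
  obtain ⟨C₂, hC₂⟩ := exists_halfAmp_integral_decay hχ hγ (-y) f h2 N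
  refine ⟨C₁ + C₂, fun k => ?_⟩
  rw [localFourier_waveDistr]
  refine (mul_le_mul_of_nonneg_right (norm_add_le _ _) (by positivity)).trans ?_
  rw [add_mul]
  exact add_le_add (hC₁ k) (hC₂ k)

theorem exists_testFn_away {s₀ y : ℝ} (h1 : s₀ ≠ y) (h2 : s₀ ≠ -y) :
    ∃ f : TestFn, f s₀ ≠ 0 ∧ (∀ᶠ s in 𝓝 y, f s = 0) ∧ ∀ᶠ s in 𝓝 (-y), f s = 0 := by
  have hopen : ({y, -y} : Set ℝ)ᶜ ∈ 𝓝 s₀ :=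
    (Set.toFinite {y, -y}).isClosed.isOpen_compl.mem_nhds (by simp [h1, h2])
  obtain ⟨f, hf, hfc, hfd, -, hf1⟩ := exists_contDiff_tsupport_subset (n := ⊤) hopen
  have hz : ∀ z ∈ ({y, -y} : Set ℝ), ∀ᶠ s in 𝓝 z, f s = 0 := fun z hz =>
    notMem_tsupport_iff_eventuallyEq.1 fun h => hf h hz
  refine ⟨⟨f, hfd, hfc, fun _ _ => trivial⟩, ?_, hz y (by simp), hz (-y) (by simp)⟩
  change f s₀ ≠ 0
  rw [hf1]
  exact one_ne_zero

/-- Only the base point is located, not the direction of the covector: favorable position will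
follow from disjoint singular supports alone. -/
theorem waveFrontSet_waveDistr (hχ : IsHighCutoff χ) (hγ : 0 < γ) {y : ℝ} {p : ℝ × ℝ}
    (hp : p ∈ waveFrontSet (waveDistr hχ hγ y)) : p.1 = y ∨ p.1 = -y := by
  by_contra! h
  obtain ⟨f, hf, h1, h2⟩ := exists_testFn_away h.1 h.2
  refine hp.2 ⟨f, hf, fun N => ?_⟩
  obtain ⟨C, hC⟩ := exists_localFourier_waveDistr_decay hχ hγ h1 h2 N
  exact ⟨C, fun k _ => hC k⟩

/-- Translation contributes a unimodular factor and conjugation reflects `k`, so decay estimates for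
the factor carry over with a shifted cut-off. -/
theorem norm_localFourier_translate_conj {E : Type} [MeasureSpace E] {c : E → ℂ} {h : E → ℝ}
    (hc : OscIntegrable c h) (t : ℝ) (f : TestFn) (k : ℝ) :
    ‖localFourier f ((oscDistr c h hc).translate t).conj k‖ =
      ‖localFourier (f.shift t) (oscDistr c h hc) (-k)‖ := by
  have key : localFourier f ((oscDistr c h hc).translate t).conj k =
      starRingEnd ℂ (Complex.exp (Complex.I * (-(t * k) : ℝ)) *
        localFourier (f.shift t) (oscDistr c h hc) (-k)) := by
    rw [oscDistr_translate_conj, localFourier_oscDistr, localFourier_oscDistr,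
      ← integral_const_mul, ← integral_conj]
    congr 1
    ext θ
    rw [waveFT_shift, map_mul, map_mul, map_mul, conj_waveFT, ← Complex.exp_conj,
      ← Complex.exp_conj, map_mul, map_mul, Complex.conj_I, Complex.conj_ofReal,
      Complex.conj_ofReal, mul_left_comm, mul_assoc,
      ← mul_assoc (Complex.exp _) (Complex.exp _), ← Complex.exp_add]
    congr 3
    · push_cast
      ring
    · ring
  rw [key, RCLike.norm_conj, norm_mul, norm_exp_I_mul_ofReal, one_mul]

theorem waveFrontSet_waveDistr_translate_conj (hχ : IsHighCutoff χ) (hγ : 0 < γ) {y t : ℝ}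
    {p : ℝ × ℝ} (hp : p ∈ waveFrontSet ((waveDistr hχ hγ y).translate t).conj) :
    p.1 + t = y ∨ p.1 + t = -y := by
  by_contra! h
  obtain ⟨f, hf, h1, h2⟩ := exists_testFn_away h.1 h.2
  have hsh : (f.shift (-t)).shift t = f := by
    ext s
    change f (s - t - -t) = f s
    congr 1
    ring
  refine hp.2 ⟨f.shift (-t), ?_, fun N => ?_⟩
  · change f (p.1 - -t) ≠ 0
    rwa [sub_neg_eq_add]
  obtain ⟨C, hC⟩ := exists_localFourier_waveDistr_decay hχ hγ h1 h2 N
  refine ⟨C, fun k _ => ?_⟩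
  have := hC (-k)
  rw [abs_neg] at this
  rwa [waveDistr, norm_localFourier_translate_conj, hsh]

end Amplitude

section Correlation

variable {χ : ℝ → ℝ} {x γ : ℝ}

/-! ### Integrability of the double amplitude -/

theorem corrAmp_eq_mul (χ : ℝ → ℝ) (γ : ℝ) (p : ℝ × ℝ) :
    corrAmp χ γ p = waveAmp χ 1 p.1 * waveAmp χ γ p.2 := by
  rw [corrAmp, waveAmp, waveAmp, div_one, one_mul, div_mul_div_comm]
  congr 1
  ring

theorem contDiff_corrAmp (hχ : IsHighCutoff χ) (hγ : 0 < γ) : ContDiff ℝ ∞ (corrAmp χ γ) := by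
  rw [funext (corrAmp_eq_mul χ γ)]
  exact ((contDiff_waveAmp hχ one_pos).comp contDiff_fst).mul
    ((contDiff_waveAmp hχ hγ).comp contDiff_snd)

theorem exists_corrAmp_bound (hχ : IsHighCutoff χ) (hγ : 0 < γ) :
    ∃ C : ℝ, 0 ≤ C ∧ ∀ p, |corrAmp χ γ p| ≤ C * ((1 + |p.1|)⁻¹ * (1 + |p.2|)⁻¹) := by
  obtain ⟨C₁, hC₁, h₁⟩ := exists_waveAmp_bound hχ one_pos
  obtain ⟨C₂, hC₂, h₂⟩ := exists_waveAmp_bound hχ hγ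
  refine ⟨C₁ * C₂, by positivity, fun p => ?_⟩
  rw [corrAmp_eq_mul, abs_mul, ← mul_inv, ← div_eq_mul_inv, le_div_iff₀ (by positivity)]
  calc _ = ((1 + |p.1|) * |waveAmp χ 1 p.1|) * ((1 + |p.2|) * |waveAmp χ γ p.2|) := by ring
    _ ≤ _ := mul_le_mul (h₁ _) (h₂ _) (by positivity) hC₁

theorem integrable_inv_mul_inv_add_mul (a : ℝ) :
    Integrable (fun p : ℝ × ℝ => (1 + p.1 ^ 2)⁻¹ * (1 + (p.2 + a * p.1) ^ 2)⁻¹) := by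
  have hcont : Continuous fun p : ℝ × ℝ => (1 + p.1 ^ 2)⁻¹ * (1 + (p.2 + a * p.1) ^ 2)⁻¹ := by
    refine Continuous.mul (Continuous.inv₀ (by fun_prop) fun p => ?_)
      (Continuous.inv₀ (by fun_prop) fun p => ?_) <;> positivity
  refine (integrable_prod_iff hcont.aestronglyMeasurable).2 ⟨Eventually.of_forall fun ξ => ?_, ?_⟩
  · exact (integrable_inv_one_add_sq.comp_add_right (a * ξ)).const_mul ((1 + ξ ^ 2)⁻¹)
  · refine (integrable_inv_one_add_sq.mul_const Real.pi).congr (Eventually.of_forall fun ξ => ?_)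
    have h1 : ∀ η : ℝ, ‖(1 + ξ ^ 2)⁻¹ * (1 + (η + a * ξ) ^ 2)⁻¹‖ =
        (1 + ξ ^ 2)⁻¹ * (1 + (η + a * ξ) ^ 2)⁻¹ := fun η => Real.norm_of_nonneg (by positivity)
    simp only [h1]
    rw [integral_const_mul, integral_add_right_eq_self (fun η : ℝ => (1 + η ^ 2)⁻¹),
      integral_univ_inv_one_add_sq]

theorem inv_mul_inv_le_add {A B : ℝ} (hA : 0 ≤ A) (hB : 0 ≤ B) :
    (1 + A)⁻¹ * (1 + B)⁻¹ ≤ (1 + A ^ 2)⁻¹ + (1 + B ^ 2)⁻¹ := by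
  have h1 : (1 + A)⁻¹ * (1 + A)⁻¹ ≤ (1 + A ^ 2)⁻¹ := by
    rw [← mul_inv]
    exact inv_anti₀ (by positivity) (by nlinarith)
  have h2 : (1 + B)⁻¹ * (1 + B)⁻¹ ≤ (1 + B ^ 2)⁻¹ := by
    rw [← mul_inv]
    exact inv_anti₀ (by positivity) (by nlinarith)
  have h3 : 0 ≤ (1 + A)⁻¹ * (1 + B)⁻¹ := by positivity
  nlinarith [sq_nonneg ((1 + A)⁻¹ - (1 + B)⁻¹)]

/-- The frequency `|ξ| - |η|` of the phase function. -/
def corrFreq (p : ℝ × ℝ) : ℝ := |p.1| - |p.2|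

/-- The part of the phase function that does not depend on `s`. -/
def corrShift (x γ t : ℝ) (p : ℝ × ℝ) : ℝ := -(t * |p.2|) - x * (p.1 - p.2 / γ)

theorem continuous_corrFreq : Continuous corrFreq := by
  unfold corrFreq
  fun_prop

theorem continuous_corrShift (x γ t : ℝ) : Continuous (corrShift x γ t) := by
  unfold corrShift
  fun_prop

theorem corrPhase_eq (x γ t s : ℝ) (p : ℝ × ℝ) :
    corrPhase x γ t s p = s * corrFreq p + corrShift x γ t p := by
  rw [corrPhase, corrFreq, corrShift]
  ring

/-- Up to sign, `|ξ| - |η|` is always one of `η + ξ`, `η - ξ`. -/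
theorem inv_one_add_corrFreq_le (p : ℝ × ℝ) : (1 + corrFreq p ^ 2)⁻¹ ≤
    (1 + (p.2 + 1 * p.1) ^ 2)⁻¹ + (1 + (p.2 + (-1) * p.1) ^ 2)⁻¹ := by
  have h1 : corrFreq p ^ 2 = (p.2 + 1 * p.1) ^ 2 ∨ corrFreq p ^ 2 = (p.2 + (-1) * p.1) ^ 2 := by
    rw [corrFreq]
    rcases abs_cases p.1 with ⟨h, -⟩ | ⟨h, -⟩ <;> rcases abs_cases p.2 with ⟨h', -⟩ | ⟨h', -⟩ <;>
      rw [h, h']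
    · right; ring
    · left; ring
    · left; ring
    · right; ring
  have h2 : (0 : ℝ) ≤ (1 + (p.2 + 1 * p.1) ^ 2)⁻¹ := by positivity
  have h3 : (0 : ℝ) ≤ (1 + (p.2 + (-1) * p.1) ^ 2)⁻¹ := by positivity
  rcases h1 with h | h <;> rw [h] <;> linarith

/-- The weight in `|ξ| - |η|` is concentrated in strips about `η = ±ξ`. By `inv_mul_inv_le_add` the
amplitude is at most `(1 + ξ²)⁻¹ + (1 + η²)⁻¹`; each summand is integrable along the strips, and the
integral across a strip is `π`. This is what makes every correlation integral below converge, at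
degenerate times included. -/
theorem integrable_corr_majorant :
    Integrable fun p : ℝ × ℝ => (1 + |p.1|)⁻¹ * (1 + |p.2|)⁻¹ * (1 + corrFreq p ^ 2)⁻¹ := by
  have hM : ∀ a : ℝ, a = 1 ∨ a = -1 → Integrable fun p : ℝ × ℝ =>
      ((1 + p.1 ^ 2)⁻¹ + (1 + p.2 ^ 2)⁻¹) * (1 + (p.2 + a * p.1) ^ 2)⁻¹ := by
    intro a ha
    refine ((integrable_inv_mul_inv_add_mul a).add (integrable_inv_mul_inv_add_mul a).swap).congr
      (Eventually.of_forall fun p => ?_)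
    have : (p.1 + a * p.2) ^ 2 = (p.2 + a * p.1) ^ 2 := by rcases ha with rfl | rfl <;> ring
    simp only [Pi.add_apply, Function.comp_apply, Prod.swap, this]
    ring
  refine Integrable.mono' ((hM 1 (Or.inl rfl)).add (hM (-1) (Or.inr rfl)))
    (Continuous.aestronglyMeasurable ?_) (Eventually.of_forall fun p => ?_)
  · have := continuous_corrFreq
    refine ((Continuous.inv₀ (by fun_prop) fun p => ?_).mul
      (Continuous.inv₀ (by fun_prop) fun p => ?_)).mul
      (Continuous.inv₀ (by fun_prop) fun p => ?_) <;> positivity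
  · rw [Real.norm_of_nonneg (by positivity), Pi.add_apply, ← mul_add]
    refine mul_le_mul ?_ (inv_one_add_corrFreq_le p) (by positivity) (by positivity)
    have := inv_mul_inv_le_add (abs_nonneg p.1) (abs_nonneg p.2)
    rwa [sq_abs, sq_abs] at this

/-- An amplitude is dominated by the amplitude of the correlation. -/
structure CorrDominated (b : ℝ × ℝ → ℝ) : Prop where
  continuous : Continuous b
  bound : ∃ C : ℝ, 0 ≤ C ∧ ∀ p, |b p| ≤ C * ((1 + |p.1|)⁻¹ * (1 + |p.2|)⁻¹)

theorem corrDominated_mul_corrAmp (hχ : IsHighCutoff χ) (hγ : 0 < γ) {m : ℝ × ℝ → ℝ}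
    (hm : Continuous m) {M : ℝ} (hM : ∀ p, |m p| ≤ M) :
    CorrDominated (fun p => m p * corrAmp χ γ p) := by
  obtain ⟨C, hC, h⟩ := exists_corrAmp_bound hχ hγ
  have hM0 : 0 ≤ M := (abs_nonneg _).trans (hM 0)
  refine ⟨hm.mul (contDiff_corrAmp hχ hγ).continuous, M * C, by positivity, fun p => ?_⟩
  rw [abs_mul, mul_assoc]
  exact mul_le_mul (hM p) (h p) (abs_nonneg _) hM0

theorem corrDominated_corrAmp (hχ : IsHighCutoff χ) (hγ : 0 < γ) : CorrDominated (corrAmp χ γ) :=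
  ⟨(contDiff_corrAmp hχ hγ).continuous, exists_corrAmp_bound hχ hγ⟩

theorem CorrDominated.oscIntegrable {b : ℝ × ℝ → ℝ} (hb : CorrDominated b) (x γ t : ℝ) :
    OscIntegrable (fun p : ℝ × ℝ => (b p : ℂ) * Complex.exp (Complex.I * (corrShift x γ t p : ℂ)))
      corrFreq := by
  obtain ⟨C, hC, h⟩ := hb.bound
  refine ⟨continuous_corrFreq.measurable, Integrable.mono' (integrable_corr_majorant.const_mul C)
    (Continuous.aestronglyMeasurable ?_) (Eventually.of_forall fun p => ?_)⟩
  · have := continuous_corrFreq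
    exact ((Complex.continuous_ofReal.comp hb.continuous).mul
      (continuous_exp_I_mul (continuous_corrShift x γ t))).mul
      (Complex.continuous_ofReal.comp (Continuous.inv₀ (by fun_prop) fun p => by positivity))
  · rw [norm_mul, norm_mul, norm_exp_I_mul_ofReal, Complex.norm_real, Complex.norm_real, mul_one,
      Real.norm_eq_abs, Real.norm_of_nonneg (by positivity), ← mul_assoc]
    exact mul_le_mul_of_nonneg_right (h p) (by positivity)

/-- The distribution `∬ exp(i φ_t(s; ξ, η)) b(ξ, η) dξ dη`. -/
def corrDistr (x γ t : ℝ) {b : ℝ × ℝ → ℝ} (hb : CorrDominated b) : Distr :=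
  oscDistr _ _ (hb.oscIntegrable x γ t)

theorem corrDistr_apply (x γ t : ℝ) {b : ℝ × ℝ → ℝ} (hb : CorrDominated b) (ψ : TestFn) :
    corrDistr x γ t hb ψ = ∫ p : ℝ × ℝ, (b p : ℂ) *
      Complex.exp (Complex.I * (corrShift x γ t p : ℂ)) * waveFT ψ (corrFreq p) := rfl

theorem CorrDominated.integrable {b : ℝ × ℝ → ℝ} (hb : CorrDominated b) (x γ t : ℝ) (ψ : TestFn) :
    Integrable fun p : ℝ × ℝ => (b p : ℂ) *
      Complex.exp (Complex.I * (corrShift x γ t p : ℂ)) * waveFT ψ (corrFreq p) :=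
  integrable_mul_waveFT (hb.oscIntegrable x γ t) ψ.contDiff ψ.hasCompactSupport

theorem isCutoffLimit_corrDistr (x γ t : ℝ) {b : ℝ × ℝ → ℝ} (hb : CorrDominated b) :
    IsCutoffLimit (corrPhase x γ t) b (corrDistr x γ t hb) :=
  isCutoffLimit_oscDistr hb.continuous continuous_corrFreq (continuous_corrShift x γ t)
    (corrPhase_eq x γ t) _

/-- The correlation `w_{x,t}`. -/
def corrProduct (hχ : IsHighCutoff χ) (hγ : 0 < γ) (x t : ℝ) : Distr :=
  corrDistr x γ t (corrDominated_corrAmp hχ hγ)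

theorem oscDistr_congr {E : Type} [MeasureSpace E] {c c' : E → ℂ} {h h' : E → ℝ}
    (hc : OscIntegrable c h) (hc' : OscIntegrable c' h') (h1 : c = c') (h2 : h = h') :
    oscDistr c h hc = oscDistr c' h' hc' := by
  subst h1 h2
  rfl

theorem isFourierProduct_corrProduct (hχ : IsHighCutoff χ) (hγ : 0 < γ) (x t : ℝ) :
    IsFourierProduct (waveDistr hχ one_pos x)
      ((waveDistr hχ hγ (x / γ)).translate t).conj (corrProduct hχ hγ x t) := by
  have hcoef : (fun p : ℝ × ℝ => ((waveAmp χ 1 p.1 : ℂ) *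
      Complex.exp (Complex.I * (-(x * p.1) : ℝ))) *
      (starRingEnd ℂ ((waveAmp χ γ p.2 : ℂ) * Complex.exp (Complex.I * (-(x / γ * p.2) : ℝ))) *
        Complex.exp (Complex.I * (-(t * |p.2|) : ℝ)))) =
      fun p => (corrAmp χ γ p : ℂ) * Complex.exp (Complex.I * (corrShift x γ t p : ℂ)) := by
    ext p
    have he : Complex.exp (Complex.I * (corrShift x γ t p : ℂ)) =
        Complex.exp (Complex.I * (-(x * p.1) : ℝ)) *
        (Complex.exp (-Complex.I * (-(x / γ * p.2) : ℝ)) *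
          Complex.exp (Complex.I * (-(t * |p.2|) : ℝ))) := by
      rw [← Complex.exp_add, ← Complex.exp_add, corrShift]
      congr 1
      push_cast
      ring
    rw [corrAmp_eq_mul, he, map_mul, Complex.conj_ofReal, ← Complex.exp_conj, map_mul,
      Complex.conj_I, Complex.conj_ofReal]
    push_cast
    ring
  have hfreq : (fun p : ℝ × ℝ => |p.1| + -|p.2|) = corrFreq := by
    ext p
    rw [corrFreq, sub_eq_add_neg]
  have hosc := (corrDominated_corrAmp hχ hγ).oscIntegrable x γ t
  rw [← hcoef, ← hfreq] at hosc
  have key := isFourierProduct_oscDistr (oscIntegrable_waveAmp hχ one_pos x)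
    ((oscIntegrable_waveAmp hχ hγ (x / γ)).conj_translate t) hosc
  rw [← oscDistr_translate_conj, oscDistr_congr hosc
    ((corrDominated_corrAmp hχ hγ).oscIntegrable x γ t) hcoef hfreq] at key
  exact key

/-! ### The phase function -/

theorem corrAmp_eventually_zero_fst (hχ : IsHighCutoff χ) (η : ℝ) :
    ∀ᶠ p in 𝓝 ((0 : ℝ), η), corrAmp χ γ p = 0 := by
  have := (continuous_fst.tendsto ((0 : ℝ), η)).eventually
    (waveAmp_eventually_zero (γ := 1) hχ)
  filter_upwards [this] with p hp
  rw [corrAmp_eq_mul, hp, zero_mul]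

theorem corrAmp_eventually_zero_snd (hχ : IsHighCutoff χ) (ξ : ℝ) :
    ∀ᶠ p in 𝓝 (ξ, (0 : ℝ)), corrAmp χ γ p = 0 := by
  have := (continuous_snd.tendsto (ξ, (0 : ℝ))).eventually
    (waveAmp_eventually_zero (γ := γ) hχ)
  filter_upwards [this] with p hp
  rw [corrAmp_eq_mul, hp, mul_zero]

theorem contDiffAt_corrPhase (x γ t s : ℝ) {p : ℝ × ℝ} (h1 : p.1 ≠ 0) (h2 : p.2 ≠ 0) :
    ContDiffAt ℝ ∞ (fun q : ℝ × (ℝ × ℝ) => corrPhase x γ t q.1 q.2) (s, p) := by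
  have hs : ContDiffAt ℝ ∞ (fun q : ℝ × (ℝ × ℝ) => q.1) (s, p) := contDiffAt_fst
  have hξ : ContDiffAt ℝ ∞ (fun q : ℝ × (ℝ × ℝ) => q.2.1) (s, p) :=
    (contDiff_fst.comp contDiff_snd).contDiffAt
  have hη : ContDiffAt ℝ ∞ (fun q : ℝ × (ℝ × ℝ) => q.2.2) (s, p) :=
    (contDiff_snd.comp contDiff_snd).contDiffAt
  have hξ' : ContDiffAt ℝ ∞ (fun q : ℝ × (ℝ × ℝ) => |q.2.1|) (s, p) := hξ.abs h1
  have hη' : ContDiffAt ℝ ∞ (fun q : ℝ × (ℝ × ℝ) => |q.2.2|) (s, p) := hη.abs h2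
  exact ((hs.mul (hξ'.sub hη')).sub (contDiffAt_const.mul hη')).sub
    (contDiffAt_const.mul (hξ.sub (hη.div_const γ)))

theorem hasDerivAt_abs_add {ξ : ℝ} (h : ξ ≠ 0) :
    HasDerivAt (fun ε : ℝ => |ξ + ε|) (SignType.sign ξ : ℝ) 0 := by
  have h1 : HasDerivAt (fun y : ℝ => |y|) (SignType.sign ξ : ℝ) (ξ + 0) := by
    rw [add_zero]
    exact hasDerivAt_abs h
  simpa using h1.comp_const_add ξ 0

/-- The critical points of the phase function lie on the critical half-rays. -/
theorem exists_of_fderiv_corrPhase_eq_zero {x γ t s : ℝ} {p : ℝ × ℝ} (h1 : p.1 ≠ 0) (h2 : p.2 ≠ 0)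
    (h : fderiv ℝ (fun q : ℝ × (ℝ × ℝ) => corrPhase x γ t q.1 q.2) (s, p) = 0) :
    ∃ q ∈ criticalRays x γ t, ∃ r : ℝ, 0 < r ∧ p = (q.1 * r, q.2 * r) := by
  obtain ⟨ξ, η⟩ := p
  simp only at h1 h2
  have hd : DifferentiableAt ℝ (fun q : ℝ × (ℝ × ℝ) => corrPhase x γ t q.1 q.2) (s, (ξ, η)) :=
    (contDiffAt_corrPhase x γ t s h1 h2).differentiableAt (by simp)
  -- The three coordinate derivatives give `|ξ| = |η|`, then `s = σ x`, then `s + t = τ x / γ`, with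
  -- `σ`, `τ` the signs of `ξ`, `η`. Eliminating `s` leaves the defining relation of a critical ray.
  have hs : |ξ| - |η| = 0 := by
    by_contra h0
    refine fderiv_ne_zero_of_deriv_comp (v := (1, (0, 0))) (d := |ξ| - |η|) hd ?_ h0 h
    have : (fun ε : ℝ => corrPhase x γ t ((s, (ξ, η)) + ε • ((1 : ℝ), ((0 : ℝ), (0 : ℝ)))).1
        ((s, (ξ, η)) + ε • ((1 : ℝ), ((0 : ℝ), (0 : ℝ)))).2) =
        fun ε => (s + ε) * (|ξ| - |η|) - (t * |η| + x * (ξ - η / γ)) := by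
      ext ε
      simp [corrPhase]
      ring
    rw [this]
    simpa using (((hasDerivAt_id (0 : ℝ)).const_add s).mul_const (|ξ| - |η|)).sub_const
      (t * |η| + x * (ξ - η / γ))
  have hξ : s * (SignType.sign ξ : ℝ) - x = 0 := by
    by_contra h0
    refine fderiv_ne_zero_of_deriv_comp (v := (0, (1, 0)))
      (d := s * (SignType.sign ξ : ℝ) - x) hd ?_ h0 h
    have : (fun ε : ℝ => corrPhase x γ t ((s, (ξ, η)) + ε • ((0 : ℝ), ((1 : ℝ), (0 : ℝ)))).1
        ((s, (ξ, η)) + ε • ((0 : ℝ), ((1 : ℝ), (0 : ℝ)))).2) =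
        fun ε => (s * |ξ + ε| - x * (ξ + ε)) - (s * |η| + t * |η| - x * (η / γ)) := by
      ext ε
      simp [corrPhase]
      ring
    rw [this]
    simpa using (((hasDerivAt_abs_add h1).const_mul s).sub
      (((hasDerivAt_id (0 : ℝ)).const_add ξ).const_mul x)).sub_const
      (s * |η| + t * |η| - x * (η / γ))
  have hη : -(s + t) * (SignType.sign η : ℝ) + x / γ = 0 := by
    by_contra h0
    refine fderiv_ne_zero_of_deriv_comp (v := (0, (0, 1)))
      (d := -(s + t) * (SignType.sign η : ℝ) + x / γ) hd ?_ h0 h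
    have : (fun ε : ℝ => corrPhase x γ t ((s, (ξ, η)) + ε • ((0 : ℝ), ((0 : ℝ), (1 : ℝ)))).1
        ((s, (ξ, η)) + ε • ((0 : ℝ), ((0 : ℝ), (1 : ℝ)))).2) =
        fun ε => (-(s + t) * |η + ε| + x / γ * (η + ε)) + (s * |ξ| - x * ξ) := by
      ext ε
      simp [corrPhase]
      ring
    rw [this]
    simpa using (((hasDerivAt_abs_add h2).const_mul (-(s + t))).add
      (((hasDerivAt_id (0 : ℝ)).const_add η).const_mul (x / γ))).add_const (s * |ξ| - x * ξ)
  refine ⟨((SignType.sign ξ : ℝ), (SignType.sign η : ℝ)), ?_, |ξ|, abs_pos.2 h1, ?_⟩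
  · rw [criticalRays, Finset.mem_filter]
    rcases lt_or_gt_of_ne h1 with a | a <;> rcases lt_or_gt_of_ne h2 with b | b <;>
      simp [a, b] at hξ hη ⊢ <;> linarith [mul_div_assoc (-1 : ℝ) x γ, neg_div γ x]
  · rw [sub_eq_zero] at hs
    ext
    · exact (sign_mul_abs ξ).symm
    · simp only
      rw [hs]
      exact (sign_mul_abs η).symm

theorem isPhaseFunctionOn_corrPhase {t : ℝ} {A : Set (ℝ × ℝ)} (h1 : ∀ p ∈ A, p.1 ≠ 0)
    (h2 : ∀ p ∈ A, p.2 ≠ 0)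
    (h : ∀ q ∈ criticalRays x γ t, ∀ r : ℝ, 0 < r → (q.1 * r, q.2 * r) ∉ A) :
    IsPhaseFunctionOn (corrPhase x γ t) A := by
  intro s p hp
  refine ⟨fun r hr => ?_, contDiffAt_corrPhase x γ t s (h1 p hp) (h2 p hp), fun h0 => ?_⟩
  · simp only [corrPhase, Prod.smul_fst, Prod.smul_snd, smul_eq_mul, abs_mul, abs_of_pos hr]
    ring
  · obtain ⟨q, hq, r, hr, rfl⟩ := exists_of_fderiv_corrPhase_eq_zero (h1 p hp) (h2 p hp) h0
    exact h q hq r hr hp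

theorem criticalRays_eq_empty {t : ℝ} (ht : t ∉ degenerateTimes x γ) :
    criticalRays x γ t = ∅ := by
  rw [criticalRays, Finset.filter_eq_empty_iff]
  intro q hq h
  refine ht ?_
  rw [h, degenerateTimes]
  simp only [Finset.mem_insert, Finset.mem_singleton] at hq
  simp only [mem_insert_iff, mem_singleton_iff]
  rcases hq with rfl | rfl | rfl | rfl
  · right; right; right; ring
  · right; left; ring
  · left; ring
  · right; right; left; ring

theorem isOscInt_corrProduct (hχ : IsHighCutoff χ) (hγ : 0 < γ) {t : ℝ}
    (ht : t ∉ degenerateTimes x γ) :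
    IsOscInt (corrPhase x γ t) (corrAmp χ γ) (corrProduct hχ hγ x t) := by
  refine ⟨contDiff_corrAmp hχ hγ, isPhaseFunctionOn_corrPhase ?_ ?_ ?_,
    isCutoffLimit_corrDistr x γ t _⟩
  · rintro ⟨ξ, η⟩ hp (rfl : ξ = 0)
    exact notMem_tsupport_of_eventually_zero (corrAmp_eventually_zero_fst hχ η) hp
  · rintro ⟨ξ, η⟩ hp (rfl : η = 0)
    exact notMem_tsupport_of_eventually_zero (corrAmp_eventually_zero_snd hχ ξ) hp
  · rw [criticalRays_eq_empty ht]
    simp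

/-- Singularities sit at `s = ±x` and at `s + t = ±x / γ`; a common base point would force `t` to be
degenerate. -/
theorem wffavorable_waveDistr (hχ : IsHighCutoff χ) (hγ : 0 < γ) {t : ℝ}
    (ht : t ∉ degenerateTimes x γ) :
    WFFavorable (waveDistr hχ one_pos x) ((waveDistr hχ hγ (x / γ)).translate t).conj := by
  intro s k h1 h2
  refine ht ?_
  have h1 := waveFrontSet_waveDistr hχ one_pos h1
  have h2 := waveFrontSet_waveDistr_translate_conj hχ hγ h2
  simp only at h1 h2
  simp only [degenerateTimes, mem_insert_iff, mem_singleton_iff, mul_add, mul_sub, mul_one,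
    mul_one_div]
  rcases h1 with rfl | rfl <;> rcases h2 with h2 | h2
  · right; right; right; linarith
  · right; left; linarith
  · left; linarith
  · right; right; left; linarith

end Correlation

section Rays

variable {χ : ℝ → ℝ} {x γ : ℝ}

/-! ### Coordinates adapted to a half-ray -/

/-- The sign pairs. -/
def signPairs : Finset (ℝ × ℝ) :=
  open scoped Classical in {(1, 1), (1, -1), (-1, 1), (-1, -1)}

theorem eq_or_eq_of_mem_signPairs {q : ℝ × ℝ} (hq : q ∈ signPairs) :
    (q.1 = 1 ∨ q.1 = -1) ∧ (q.2 = 1 ∨ q.2 = -1) := by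
  simp only [signPairs, Finset.mem_insert, Finset.mem_singleton] at hq
  rcases hq with rfl | rfl | rfl | rfl <;> simp

theorem mem_criticalRays_iff {t : ℝ} {q : ℝ × ℝ} :
    q ∈ criticalRays x γ t ↔ q ∈ signPairs ∧ t = q.2 * x / γ - q.1 * x := by
  rw [criticalRays, Finset.mem_filter, signPairs]

/-- The coordinates `(p, r) ↦ (σ (p + r), τ p)`. -/
def rayMap (q z : ℝ × ℝ) : ℝ × ℝ := (q.1 * (z.1 + z.2), q.2 * z.1)

theorem measurePreserving_sign_mul {σ : ℝ} (h : σ = 1 ∨ σ = -1) :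
    MeasurePreserving (fun s : ℝ => σ * s) := by
  rcases h with rfl | rfl
  · simp only [one_mul]
    exact MeasurePreserving.id _
  · simpa using Measure.measurePreserving_neg (volume : Measure ℝ)

/-- A shear, a swap and sign changes, each of which preserves Lebesgue measure. -/
theorem measurePreserving_rayMap {q : ℝ × ℝ} (hq : q ∈ signPairs) :
    MeasurePreserving (rayMap q) := by
  obtain ⟨h1, h2⟩ := eq_or_eq_of_mem_signPairs hq
  exact ((measurePreserving_sign_mul h1).prod (measurePreserving_sign_mul h2)).comp
    (Measure.measurePreserving_swap.comp
      (measurePreserving_prod_add (volume : Measure ℝ) (volume : Measure ℝ)))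

theorem corrFreq_rayMap {q z : ℝ × ℝ} (hq : q ∈ signPairs) (h1 : 0 < z.1 + z.2) (h2 : 0 < z.1) :
    corrFreq (rayMap q z) = z.2 := by
  obtain ⟨h3, h4⟩ := eq_or_eq_of_mem_signPairs hq
  have h5 : |q.1| = 1 := by rcases h3 with h | h <;> simp [h]
  have h6 : |q.2| = 1 := by rcases h4 with h | h <;> simp [h]
  rw [corrFreq, rayMap, abs_mul, abs_mul, h5, h6, abs_of_pos h1, abs_of_pos h2]
  ring

theorem corrShift_rayMap {q z : ℝ × ℝ} (hq : q ∈ signPairs) (t : ℝ) (h2 : 0 < z.1) :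
    corrShift x γ t (rayMap q z) =
      z.1 * (q.2 * x / γ - q.1 * x - t) + -(q.1 * x * z.2) := by
  obtain ⟨-, h4⟩ := eq_or_eq_of_mem_signPairs hq
  have h6 : |q.2| = 1 := by rcases h4 with h | h <;> simp [h]
  rw [corrShift, rayMap, abs_mul, h6, abs_of_pos h2]
  ring

theorem pos_of_sign_mul_pos {σ r : ℝ} (h : σ = 1 ∨ σ = -1) (h' : 0 < σ * (σ * r)) : 0 < r := by
  rcases h with rfl | rfl <;> linarith

/-- Inside one quadrant the phase is linear in the adapted coordinates: `s` couples only to `r` and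
`t` only to `p`. The coefficient of `p` vanishes exactly when the half-ray is critical. -/
theorem integrable_and_corrDistr_eq_ray {b : ℝ × ℝ → ℝ} (hb : CorrDominated b) {q : ℝ × ℝ}
    (hq : q ∈ signPairs) (hs : ∀ p, b p ≠ 0 → 0 < q.1 * p.1 ∧ 0 < q.2 * p.2) (t : ℝ) (ψ : TestFn) :
    Integrable (fun z : ℝ × ℝ => (b (rayMap q z) : ℂ) *
      Complex.exp (Complex.I * (z.1 * (q.2 * x / γ - q.1 * x - t) : ℝ)) *
        (Complex.exp (Complex.I * (-(q.1 * x * z.2) : ℝ)) * waveFT ψ z.2)) ∧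
    corrDistr x γ t hb ψ = ∫ z : ℝ × ℝ, (b (rayMap q z) : ℂ) *
      Complex.exp (Complex.I * (z.1 * (q.2 * x / γ - q.1 * x - t) : ℝ)) *
        (Complex.exp (Complex.I * (-(q.1 * x * z.2) : ℝ)) * waveFT ψ z.2) := by
  obtain ⟨h1, h2⟩ := eq_or_eq_of_mem_signPairs hq
  have hmp := measurePreserving_rayMap hq
  have hint := hb.integrable x γ t ψ
  have hcomp : (fun z : ℝ × ℝ => (b (rayMap q z) : ℂ) *
      Complex.exp (Complex.I * (z.1 * (q.2 * x / γ - q.1 * x - t) : ℝ)) *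
        (Complex.exp (Complex.I * (-(q.1 * x * z.2) : ℝ)) * waveFT ψ z.2)) =
      (fun p : ℝ × ℝ => (b p : ℂ) * Complex.exp (Complex.I * (corrShift x γ t p : ℂ)) *
        waveFT ψ (corrFreq p)) ∘ rayMap q := by
    ext z
    simp only [Function.comp_apply]
    by_cases h0 : b (rayMap q z) = 0
    · rw [h0]
      simp
    obtain ⟨h3, h4⟩ := hs _ h0
    have h3 := pos_of_sign_mul_pos h1 h3
    have h4 := pos_of_sign_mul_pos h2 h4
    rw [corrFreq_rayMap hq h3 h4, corrShift_rayMap hq t h4, Complex.ofReal_add, mul_add,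
      Complex.exp_add]
    ring
  rw [hcomp]
  refine ⟨hmp.integrable_comp_of_integrable hint, ?_⟩
  rw [corrDistr_apply]
  have := integral_map (μ := volume) hmp.measurable.aemeasurable
    (f := fun p : ℝ × ℝ => (b p : ℂ) * Complex.exp (Complex.I * (corrShift x γ t p : ℂ)) *
        waveFT ψ (corrFreq p)) (by rw [hmp.map_eq]; exact hint.aestronglyMeasurable)
  rw [hmp.map_eq] at this
  exact this

/-! ### Weak regularity in time -/

/-- The part of the double amplitude in one open quadrant. -/
def quadrantAmp (χ : ℝ → ℝ) (γ : ℝ) (q p : ℝ × ℝ) : ℝ :=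
  halfAmp χ 1 (q.1 * p.1) * halfAmp χ γ (q.2 * p.2)

theorem corrAmp_eq_sum (hχ : IsHighCutoff χ) (γ : ℝ) (p : ℝ × ℝ) :
    corrAmp χ γ p = ∑ q ∈ signPairs, quadrantAmp χ γ q p := by
  have h : (-1 : ℝ) ≠ 1 := by norm_num
  rw [corrAmp_eq_mul, waveAmp_eq_halfAmp hχ, waveAmp_eq_halfAmp hχ, signPairs]
  rw [Finset.sum_insert, Finset.sum_insert, Finset.sum_insert, Finset.sum_singleton]
  · simp only [quadrantAmp, one_mul, neg_mul]
    ring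
  all_goals simp [h, h.symm]

theorem corrDominated_quadrantAmp (hχ : IsHighCutoff χ) (hγ : 0 < γ) {q : ℝ × ℝ}
    (hq : q ∈ signPairs) : CorrDominated (quadrantAmp χ γ q) := by
  obtain ⟨h1, h2⟩ := eq_or_eq_of_mem_signPairs hq
  have h5 : |q.1| = 1 := by rcases h1 with h | h <;> simp [h]
  have h6 : |q.2| = 1 := by rcases h2 with h | h <;> simp [h]
  obtain ⟨C₁, hC₁, hb₁⟩ := exists_halfAmp_bound hχ one_pos
  obtain ⟨C₂, hC₂, hb₂⟩ := exists_halfAmp_bound hχ hγ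
  refine ⟨((contDiff_halfAmp hχ one_pos).continuous.comp (by fun_prop)).mul
    ((contDiff_halfAmp hχ hγ).continuous.comp (by fun_prop)), C₁ * C₂, by positivity, fun p => ?_⟩
  have e1 := hb₁ (q.1 * p.1)
  have e2 := hb₂ (q.2 * p.2)
  rw [abs_mul, h5, one_mul] at e1
  rw [abs_mul, h6, one_mul] at e2
  rw [quadrantAmp, abs_mul, ← mul_inv, ← div_eq_mul_inv, le_div_iff₀ (by positivity)]
  calc _ = ((1 + |p.1|) * |halfAmp χ 1 (q.1 * p.1)|) *
        ((1 + |p.2|) * |halfAmp χ γ (q.2 * p.2)|) := by ring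
    _ ≤ _ := mul_le_mul e1 e2 (by positivity) hC₁

theorem pos_of_quadrantAmp_ne_zero {q p : ℝ × ℝ} (h : quadrantAmp χ γ q p ≠ 0) :
    0 < q.1 * p.1 ∧ 0 < q.2 * p.2 := by
  constructor
  · by_contra! h'
    exact h (by rw [quadrantAmp, halfAmp_of_nonpos h', zero_mul])
  · by_contra! h'
    exact h (by rw [quadrantAmp, halfAmp_of_nonpos h', mul_zero])

theorem corrProduct_apply_eq_sum (hχ : IsHighCutoff χ) (hγ : 0 < γ) (t : ℝ) (ψ : TestFn) :
    corrProduct hχ hγ x t ψ = ∑ q ∈ signPairs.attach,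
      corrDistr x γ t (corrDominated_quadrantAmp hχ hγ q.2) ψ := by
  simp only [corrDistr_apply]
  rw [← integral_finsetSum _ fun q _ =>
    (corrDominated_quadrantAmp hχ hγ q.2).integrable x γ t ψ, corrProduct, corrDistr_apply]
  congr 1
  ext p
  rw [corrAmp_eq_sum hχ, ← Finset.sum_attach, Complex.ofReal_sum, Finset.sum_mul, Finset.sum_mul]

/-- The symbol whose Fourier transform describes the dependence on time. -/
def timeSymbol (χ : ℝ → ℝ) (x γ : ℝ) (q : ℝ × ℝ) (ψ : TestFn) (η : ℝ) : ℂ :=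
  (halfAmp χ γ η : ℂ) * ∫ r : ℝ, (halfAmp χ 1 (η + r) : ℂ) *
    (Complex.exp (Complex.I * (-(q.1 * x * r) : ℝ)) * waveFT ψ r)

/-- One order comes from the amplitude in `η`. The other comes from the amplitude at `η + r`,
averaged against a rapidly decreasing function of `r`. -/
theorem isSymbol_timeSymbol (hχ : IsHighCutoff χ) (hγ : 0 < γ) (q : ℝ × ℝ) (ψ : TestFn) :
    IsSymbol 2 (timeSymbol χ x γ q ψ) := by
  refine (isSymbol_halfAmp hχ hγ).mul ((isSymbol_halfAmp hχ one_pos).integral_translate ?_)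
  have h := rapidlyDecreasing_waveFT ψ.contDiff ψ.hasCompactSupport
  refine ⟨(continuous_exp_I_mul (by fun_prop)).mul h.1, fun n => ?_⟩
  obtain ⟨C, hC, hb⟩ := h.2 n
  refine ⟨C, hC, fun r => ?_⟩
  rw [norm_mul, norm_exp_I_mul_ofReal, one_mul]
  exact hb r

theorem corrDistr_quadrantAmp_eq (hχ : IsHighCutoff χ) (hγ : 0 < γ) {q : ℝ × ℝ}
    (hq : q ∈ signPairs) (t : ℝ) (ψ : TestFn) :
    corrDistr x γ t (corrDominated_quadrantAmp hχ hγ hq) ψ = ∫ η : ℝ, timeSymbol χ x γ q ψ η *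
      Complex.exp (Complex.I * (η * (q.2 * x / γ - q.1 * x - t) : ℝ)) := by
  obtain ⟨hint, heq⟩ := integrable_and_corrDistr_eq_ray (x := x) (γ := γ)
    (corrDominated_quadrantAmp hχ hγ hq) hq (fun p => pos_of_quadrantAmp_ne_zero) t ψ
  obtain ⟨h1, h2⟩ := eq_or_eq_of_mem_signPairs hq
  have hsq : ∀ {σ : ℝ}, σ = 1 ∨ σ = -1 → ∀ r, σ * (σ * r) = r := by
    rintro σ (rfl | rfl) r <;> ring
  rw [heq, Measure.volume_eq_prod, integral_prod _ hint]
  congr 1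
  ext η
  rw [timeSymbol, mul_assoc, mul_comm (∫ r : ℝ, _) _, ← mul_assoc, ← integral_const_mul]
  congr 1
  ext r
  rw [quadrantAmp, rayMap, hsq h1, hsq h2]
  push_cast
  ring

/-- Each quadrant contributes the Fourier integral of a symbol of order `-2`, evaluated at `τ x / γ
- σ x - t`. Such an integral is smooth away from frequency zero, and this frequency is zero only at
degenerate times. -/
theorem contDiffOn_corrProduct (hχ : IsHighCutoff χ) (hγ : 0 < γ) (ψ : TestFn) :
    ContDiffOn ℝ ∞ (fun t => corrProduct hχ hγ x t ψ) (degenerateTimes x γ)ᶜ := by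
  intro t ht
  refine ContDiffAt.contDiffWithinAt ?_
  have heq : (fun t => corrProduct hχ hγ x t ψ) = fun t => ∑ q ∈ signPairs.attach,
      ∫ η : ℝ, timeSymbol χ x γ q.1 ψ η *
        Complex.exp (Complex.I * (η * (q.1.2 * x / γ - q.1.1 * x - t) : ℝ)) := by
    ext t
    rw [corrProduct_apply_eq_sum]
    exact Finset.sum_congr rfl fun q _ => corrDistr_quadrantAmp_eq hχ hγ q.2 t ψ
  rw [heq]
  refine ContDiffAt.sum fun q _ => ?_
  have hθ : q.1.2 * x / γ - q.1.1 * x - t ≠ 0 := by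
    intro h0
    have hmem : q.1 ∈ criticalRays x γ t :=
      mem_criticalRays_iff.2 ⟨q.2, (sub_eq_zero.1 h0).symm⟩
    rw [criticalRays_eq_empty ht] at hmem
    simp at hmem
  exact ContDiffAt.comp (f := fun t => q.1.2 * x / γ - q.1.1 * x - t) t ((isSymbol_timeSymbol hχ hγ q.1 ψ).contDiffAt_integral_exp hθ)
    (contDiffAt_const.sub contDiffAt_id)

/-- Time enters through a unimodular factor, so the absolute value of the integrand at `t = 0`
dominates for all `t`. -/
theorem continuous_corrProduct (hχ : IsHighCutoff χ) (hγ : 0 < γ) (ψ : TestFn) :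
    Continuous (fun t => corrProduct hχ hγ x t ψ) := by
  have hb := corrDominated_corrAmp hχ hγ
  simp only [corrProduct, corrDistr_apply]
  refine continuous_of_dominated (fun t => (hb.integrable x γ t ψ).aestronglyMeasurable)
    (bound := fun p => ‖(corrAmp χ γ p : ℂ) *
      Complex.exp (Complex.I * (corrShift x γ 0 p : ℂ)) * waveFT ψ (corrFreq p)‖)
    (fun t => Eventually.of_forall fun p => ?_) (hb.integrable x γ 0 ψ).norm
    (Eventually.of_forall fun p => ?_)
  · simp only [norm_mul, norm_exp_I_mul_ofReal, le_refl]
  · refine (continuous_const.mul (continuous_exp_I_mul ?_)).mul continuous_const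
    unfold corrShift
    fun_prop

/-! ### Contributions of the critical half-rays -/

/-- The larger of `A`, `B` is at least `D / 2`. Its exponent `-1` is split as `-3/4`, given to `D`,
and `-1/4`, given to the smaller one. The exponents suit the later use: `5/4 > 1` for integrability
in `p`, and `2 · 3/4 > 1` for square integrability in `r`. -/
theorem inv_mul_inv_le_rpow {A B D : ℝ} (hA : 0 < A) (hB : 0 < B) (hD : 0 < D) (h : D ≤ A + B) :
    A⁻¹ * B⁻¹ ≤ 2 * D ^ (-(3 / 4) : ℝ) * (A ^ (-(5 / 4) : ℝ) + B ^ (-(5 / 4) : ℝ)) := by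
  have key : ∀ {A B : ℝ}, 0 < A → A ≤ B → D ≤ A + B →
      A⁻¹ * B⁻¹ ≤ 2 * D ^ (-(3 / 4) : ℝ) * A ^ (-(5 / 4) : ℝ) := by
    intro A B hA hAB h
    have hB : 0 < B := hA.trans_le hAB
    have h1 : B⁻¹ = B ^ (-(1 / 4) : ℝ) * B ^ (-(3 / 4) : ℝ) := by
      rw [← Real.rpow_add hB, ← Real.rpow_neg_one]
      norm_num
    have h2 : A ^ (-(5 / 4) : ℝ) = A⁻¹ * A ^ (-(1 / 4) : ℝ) := by
      rw [← Real.rpow_neg_one, ← Real.rpow_add hA]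
      norm_num
    have h3 : B ^ (-(1 / 4) : ℝ) ≤ A ^ (-(1 / 4) : ℝ) :=
      Real.rpow_le_rpow_of_nonpos hA hAB (by norm_num)
    have h4 : B ^ (-(3 / 4) : ℝ) ≤ 2 * D ^ (-(3 / 4) : ℝ) := by
      have h5 : B ^ (-(3 / 4) : ℝ) ≤ (D / 2) ^ (-(3 / 4) : ℝ) :=
        Real.rpow_le_rpow_of_nonpos (by positivity) (by linarith) (by norm_num)
      have h6 : (D / 2) ^ (-(3 / 4) : ℝ) = 2 ^ (3 / 4 : ℝ) * D ^ (-(3 / 4) : ℝ) := by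
        rw [Real.div_rpow hD.le (by norm_num), Real.rpow_neg (by norm_num : (0 : ℝ) ≤ 2),
          div_inv_eq_mul, mul_comm]
      have h7 : (2 : ℝ) ^ (3 / 4 : ℝ) ≤ 2 := by
        conv_rhs => rw [← Real.rpow_one 2]
        exact Real.rpow_le_rpow_of_exponent_le (by norm_num) (by norm_num)
      rw [h6] at h5
      exact h5.trans (mul_le_mul_of_nonneg_right h7 (by positivity))
    rw [h1, h2]
    calc A⁻¹ * (B ^ (-(1 / 4) : ℝ) * B ^ (-(3 / 4) : ℝ))
        ≤ A⁻¹ * (A ^ (-(1 / 4) : ℝ) * (2 * D ^ (-(3 / 4) : ℝ))) := by gcongr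
      _ = _ := by ring
  have hA' : 0 ≤ 2 * D ^ (-(3 / 4) : ℝ) * A ^ (-(5 / 4) : ℝ) := by positivity
  have hB' : 0 ≤ 2 * D ^ (-(3 / 4) : ℝ) * B ^ (-(5 / 4) : ℝ) := by positivity
  rw [mul_add]
  rcases le_total A B with hAB | hAB
  · linarith [key hA hAB h]
  · rw [mul_comm A⁻¹]
    linarith [key hB hAB (by linarith)]

/-- On the line `σ ξ - τ η = r` one has `|r| ≤ |ξ| + |η|`, so `inv_mul_inv_le_rpow` extracts `(1 +
|r|)^(-3/4)` and leaves an integrable function of `p`. -/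
theorem memLp_lineIntegral {b : ℝ × ℝ → ℝ} (hb : CorrDominated b) {q : ℝ × ℝ}
    (hq : q ∈ signPairs) : MemLp (lineIntegral b q) 2 volume := by
  obtain ⟨C, hC, hbd⟩ := hb.bound
  obtain ⟨h1, h2⟩ := eq_or_eq_of_mem_signPairs hq
  have h5 : |q.1| = 1 := by rcases h1 with h | h <;> simp [h]
  have h6 : |q.2| = 1 := by rcases h2 with h | h <;> simp [h]
  have hcont : Continuous fun z : ℝ × ℝ => ((b (q.1 * (z.2 + z.1), q.2 * z.2) : ℝ) : ℂ) :=
    Complex.continuous_ofReal.comp (hb.continuous.comp (by fun_prop))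
  have hmeas : AEStronglyMeasurable (lineIntegral b q) volume :=
    hcont.stronglyMeasurable.integral_prod_right'.aestronglyMeasurable
  have hint : Integrable fun p : ℝ => (1 + |p|) ^ (-(5 / 4) : ℝ) := by
    have := integrable_one_add_norm (E := ℝ) (μ := volume) (r := 5 / 4) (by norm_num)
    simpa only [Real.norm_eq_abs] using this
  set J : ℝ := ∫ p : ℝ, ((1 + |p|) ^ (-(5 / 4) : ℝ)) with hJ
  have hbound : ∀ r, ‖lineIntegral b q r‖ ≤ C * 4 * J * (1 + |r|) ^ (-(3 / 4) : ℝ) := by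
    intro r
    have hsum : Integrable fun p : ℝ =>
        (1 + |p + r|) ^ (-(5 / 4) : ℝ) + (1 + |p|) ^ (-(5 / 4) : ℝ) :=
      (hint.comp_add_right r).add hint
    have hval : ∫ p : ℝ, C * (2 * (1 + |r|) ^ (-(3 / 4) : ℝ)) *
        ((1 + |p + r|) ^ (-(5 / 4) : ℝ) + (1 + |p|) ^ (-(5 / 4) : ℝ)) =
        C * 4 * J * (1 + |r|) ^ (-(3 / 4) : ℝ) := by
      rw [integral_const_mul, integral_add (hint.comp_add_right r) hint,
        integral_add_right_eq_self (fun p : ℝ => (1 + |p|) ^ (-(5 / 4) : ℝ)), ← hJ]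
      ring
    rw [← hval]
    refine norm_integral_le_of_norm_le (hsum.const_mul _) (Eventually.of_forall fun p => ?_)
    rw [Complex.norm_real, Real.norm_eq_abs]
    refine (hbd _).trans ?_
    simp only [abs_mul, h5, h6, one_mul]
    rw [mul_assoc]
    refine mul_le_mul_of_nonneg_left (inv_mul_inv_le_rpow (by positivity) (by positivity)
      (by positivity) ?_) hC
    have := abs_sub (p + r) p
    rw [add_sub_cancel_left] at this
    linarith
  rw [memLp_two_iff_integrable_sq_norm hmeas]
  have hint2 : Integrable fun r : ℝ => (1 + |r|) ^ (-(3 / 2) : ℝ) := by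
    have := integrable_one_add_norm (E := ℝ) (μ := volume) (r := 3 / 2) (by norm_num)
    simpa only [Real.norm_eq_abs] using this
  refine Integrable.mono' (hint2.const_mul ((C * 4 * J) ^ 2)) (hmeas.norm.pow 2)
    (Eventually.of_forall fun r => ?_)
  rw [Real.norm_of_nonneg (by positivity)]
  refine (pow_le_pow_left₀ (norm_nonneg _) (hbound r) 2).trans (le_of_eq ?_)
  rw [mul_pow _ _ 2, ← Real.rpow_natCast ((1 + |r|) ^ (-(3 / 4) : ℝ)) 2,
    ← Real.rpow_mul (by positivity)]
  norm_num

theorem CorrDominated.memLp {b : ℝ × ℝ → ℝ} (hb : CorrDominated b) : MemLp b 2 := by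
  obtain ⟨C, hC, hbd⟩ := hb.bound
  rw [memLp_two_iff_integrable_sq hb.continuous.aestronglyMeasurable]
  refine Integrable.mono'
    ((integrable_inv_one_add_sq.mul_prod integrable_inv_one_add_sq).const_mul (C ^ 2))
    (hb.continuous.pow 2).aestronglyMeasurable (Eventually.of_forall fun p => ?_)
  have hle : ∀ r : ℝ, ((1 + |r|)⁻¹) ^ 2 ≤ (1 + r ^ 2)⁻¹ := by
    intro r
    rw [inv_pow]
    exact inv_anti₀ (by positivity) (by nlinarith [sq_abs r, abs_nonneg r])
  rw [Real.norm_of_nonneg (by positivity), ← sq_abs]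
  calc |b p| ^ 2 ≤ (C * ((1 + |p.1|)⁻¹ * (1 + |p.2|)⁻¹)) ^ 2 :=
        pow_le_pow_left₀ (abs_nonneg _) (hbd p) 2
    _ = C ^ 2 * (((1 + |p.1|)⁻¹) ^ 2 * ((1 + |p.2|)⁻¹) ^ 2) := by ring
    _ ≤ C ^ 2 * ((1 + p.1 ^ 2)⁻¹ * (1 + p.2 ^ 2)⁻¹) := by
      gcongr
      · exact hle _
      · exact hle _

theorem integral_eq_integral_sub_two_pi_mul {G : Type*} [NormedAddCommGroup G] [NormedSpace ℝ G]
    (H : ℝ → G) (a : ℝ) :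
    ∫ s, H s = (2 * Real.pi) • ∫ l : ℝ, H (a - 2 * Real.pi * l) := by
  have hpi := Real.pi_pos
  rw [Measure.integral_comp_mul_left (fun k => H (a - k)) (2 * Real.pi),
    integral_sub_left_eq_self H volume a, abs_of_pos (by positivity), smul_smul,
    mul_inv_cancel₀ (by positivity), one_smul]

/-- The transform of a square integrable function tested against a translated and rescaled test
function. -/
theorem integral_mul_waveFT_eq_fourier {g : ℝ → ℂ} (hg : MemLp g 2 volume) (a : ℝ) (ψ : TestFn) :
    ∫ r : ℝ, g r * (Complex.exp (Complex.I * (-(a * r) : ℝ)) * waveFT ψ r) =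
      ∫ s : ℝ, (ψ s : ℂ) * (𝓕 (hg.toLp _) : Lp ℂ 2 (volume : Measure ℝ))
        ((a - s) / (2 * Real.pi)) := by
  have hpi := Real.pi_pos
  have hsm : ContDiff ℝ ∞ fun l : ℝ => 2 * Real.pi * ψ (a - 2 * Real.pi * l) :=
    contDiff_const.mul (ψ.contDiff.comp (contDiff_const.sub (contDiff_const.mul contDiff_id)))
  have hcs : HasCompactSupport fun l : ℝ => 2 * Real.pi * ψ (a - 2 * Real.pi * l) := by
    refine HasCompactSupport.mul_left ?_
    exact ψ.hasCompactSupport.comp_homeomorph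
      ((Homeomorph.mulLeft₀ (2 * Real.pi) (by positivity)).trans (Homeomorph.subLeft a))
  -- The shift by `a` and the scaling by `2π` are chosen so that `𝓕 Θ`, with its kernel `exp(-2πi l
  -- r)`, is `exp(-i a r) ψ̂(r)`.
  set Θ := toSchwartz _ hsm hcs
  have hΘ : ∀ r : ℝ, (𝓕 Θ) r = Complex.exp (Complex.I * (-(a * r) : ℝ)) * waveFT ψ r := by
    intro r
    rw [waveFT, ← integral_const_mul, integral_eq_integral_sub_two_pi_mul _ a, Complex.real_smul,
      ← integral_const_mul, SchwartzMap.fourier_coe, Real.fourier_eq']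
    congr 1
    ext l
    rw [toSchwartz_apply, smul_eq_mul]
    have he : Complex.exp (((-2 * Real.pi * inner ℝ l r : ℝ) : ℂ) * Complex.I) =
        Complex.exp (Complex.I * (-(a * r) : ℝ)) *
          Complex.exp (Complex.I * ((a - 2 * Real.pi * l) * r : ℝ)) := by
      rw [← Complex.exp_add]
      congr 1
      simp only [RCLike.inner_apply, conj_trivial]
      push_cast
      ring
    rw [he]
    push_cast
    ring
  -- The `L²` transform agrees with the tempered one, which is defined by duality; this moves `𝓕`
  -- from `Θ` onto `g`.
  have key := congrArg (fun T : TemperedDistribution ℝ ℂ => T Θ)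
    (Lp.fourier_toTemperedDistribution_eq (hg.toLp g))
  simp only [TemperedDistribution.fourier_apply, Lp.toTemperedDistribution_apply] at key
  have h1 : ∫ r : ℝ, g r * (Complex.exp (Complex.I * (-(a * r) : ℝ)) * waveFT ψ r) =
      ∫ r : ℝ, (𝓕 Θ) r • (hg.toLp g) r := by
    refine integral_congr_ae ?_
    filter_upwards [hg.coeFn_toLp] with r hr
    rw [hr, hΘ, smul_eq_mul, mul_comm]
  rw [h1, key, integral_eq_integral_sub_two_pi_mul (fun s : ℝ => (ψ s : ℂ) *
    (𝓕 (hg.toLp _) : Lp ℂ 2 (volume : Measure ℝ)) ((a - s) / (2 * Real.pi))) a,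
    Complex.real_smul, ← integral_const_mul]
  congr 1
  ext l
  have h2 : (a - (a - 2 * Real.pi * l)) / (2 * Real.pi) = l := by field_simp; ring
  rw [h2, toSchwartz_apply, smul_eq_mul]
  push_cast
  ring

/-- On a critical ray the `p`-dependent exponential is identically 1, so integrating over `p` first
yields the line integral of `b`. What remains in `r` is its Fourier transform, centred at `s = σ x`.
-/
theorem corrDistr_eq_integral_fourier {b : ℝ × ℝ → ℝ} (hb : CorrDominated b) {q : ℝ × ℝ} {t : ℝ}
    (hq : q ∈ criticalRays x γ t) (hs : ∀ p, b p ≠ 0 → 0 < q.1 * p.1 ∧ 0 < q.2 * p.2)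
    (ψ : TestFn) (hg : MemLp (lineIntegral b q) 2 volume) :
    corrDistr x γ t hb ψ = ∫ s : ℝ, (ψ s : ℂ) *
      (𝓕 (hg.toLp _) : Lp ℂ 2 (volume : Measure ℝ)) ((q.1 * x - s) / (2 * Real.pi)) := by
  obtain ⟨hq1, hq2⟩ := mem_criticalRays_iff.1 hq
  obtain ⟨hint, heq⟩ := integrable_and_corrDistr_eq_ray (x := x) (γ := γ) hb hq1 hs t ψ
  rw [heq, Measure.volume_eq_prod, integral_prod_symm _ hint, ← integral_mul_waveFT_eq_fourier]
  congr 1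
  ext r
  rw [lineIntegral, ← integral_mul_const]
  congr 1
  ext p
  rw [hq2, sub_self, mul_zero, Complex.ofReal_zero, mul_zero, Complex.exp_zero, mul_one]
  rfl

/-! ### The smooth part -/

theorem contDiff_integral_mul_exp {E : Type} [NormedAddCommGroup E] [MeasureSpace E] [BorelSpace E]
    [SecondCountableTopology E] [IsFiniteMeasureOnCompacts (volume : Measure E)] {h : E → ℝ}
    (hh : Continuous h) {c : E → ℂ} (hc : Continuous c) (hcs : HasCompactSupport c) :
    ContDiff ℝ ∞ fun s : ℝ => ∫ θ, c θ * Complex.exp (Complex.I * (s * h θ : ℝ)) := by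
  rw [contDiff_infty]
  intro n
  induction n generalizing c with
  | zero =>
    rw [Nat.cast_zero, contDiff_zero]
    refine continuous_of_dominated (fun s => Continuous.aestronglyMeasurable ?_)
      (bound := fun θ => ‖c θ‖) (fun s => Eventually.of_forall fun θ => ?_)
      (hc.integrable_of_hasCompactSupport hcs).norm (Eventually.of_forall fun θ => ?_)
    · exact hc.mul (continuous_exp_I_mul (by fun_prop))
    · rw [norm_mul, norm_exp_I_mul_ofReal, mul_one]
    · exact continuous_const.mul (continuous_exp_I_mul (by fun_prop))
  | succ n ih =>
    have hc' : Continuous fun θ => c θ * (Complex.I * h θ) := by fun_prop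
    have hcs' : HasCompactSupport fun θ => c θ * (Complex.I * h θ) := hcs.mul_right
    have hd : ∀ s : ℝ, HasDerivAt (fun s : ℝ => ∫ θ, c θ * Complex.exp (Complex.I * (s * h θ : ℝ)))
        (∫ θ, c θ * (Complex.I * h θ) * Complex.exp (Complex.I * (s * h θ : ℝ))) s := by
      intro s
      refine (hasDerivAt_integral_of_dominated_loc_of_deriv_le
        (F := fun (s : ℝ) θ => c θ * Complex.exp (Complex.I * (s * h θ : ℝ)))
        (F' := fun (s : ℝ) θ => c θ * (Complex.I * h θ) * Complex.exp (Complex.I * (s * h θ : ℝ)))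
        (bound := fun θ => ‖c θ * (Complex.I * h θ)‖) univ_mem
        (Eventually.of_forall fun s => Continuous.aestronglyMeasurable ?_)
        (Continuous.integrable_of_hasCompactSupport ?_ hcs.mul_right)
        (Continuous.aestronglyMeasurable ?_) (Eventually.of_forall fun θ s _ => ?_)
        (hc'.integrable_of_hasCompactSupport hcs').norm
        (Eventually.of_forall fun θ s _ => ?_)).2
      · exact hc.mul (continuous_exp_I_mul (by fun_prop))
      · exact hc.mul (continuous_exp_I_mul (by fun_prop))
      · exact hc'.mul (continuous_exp_I_mul (by fun_prop))
      · rw [norm_mul, norm_exp_I_mul_ofReal, mul_one]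
      · have h1 : HasDerivAt (fun s : ℝ => Complex.I * ((s * h θ : ℝ) : ℂ))
            (Complex.I * (h θ : ℂ)) s := by
          have := ((hasDerivAt_id s).mul_const (h θ)).ofReal_comp.const_mul Complex.I
          simpa using this
        have h2 := h1.cexp.const_mul (c θ)
        convert! h2 using 1
        ring
    rw [Nat.cast_add, Nat.cast_one, contDiff_succ_iff_deriv]
    refine ⟨fun s => (hd s).differentiableAt, by simp, ?_⟩
    rw [funext fun s => (hd s).deriv]
    exact ih hc' hcs'

end Rays

section Decomposition

variable {χ : ℝ → ℝ} {x γ : ℝ}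

/-! ### The decomposition at a fixed time -/

/-- The sum of the cut-offs near the critical half-rays. -/
def raySum (x γ t : ℝ) (μ : ℝ × ℝ → ℝ × ℝ → ℝ) (p : ℝ × ℝ) : ℝ := ∑ q ∈ criticalRays x γ t, μ q p

theorem contDiff_raySum {t : ℝ} {μ : ℝ × ℝ → ℝ × ℝ → ℝ}
    (hμ : ∀ q ∈ criticalRays x γ t, IsRayCutoff q (μ q)) : ContDiff ℝ ∞ (raySum x γ t μ) :=
  ContDiff.sum fun q hq => (hμ q hq).smooth

theorem abs_one_sub_raySum_le {t : ℝ} {μ : ℝ × ℝ → ℝ × ℝ → ℝ}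
    (hμ : ∀ q ∈ criticalRays x γ t, IsRayCutoff q (μ q)) (p : ℝ × ℝ) :
    |1 - raySum x γ t μ p| ≤ 1 + (criticalRays x γ t).card := by
  have h0 : 0 ≤ raySum x γ t μ p := Finset.sum_nonneg fun q hq => ((hμ q hq).mem_Icc p).1
  have h1 : raySum x γ t μ p ≤ (criticalRays x γ t).card := by
    have := Finset.sum_le_sum (s := criticalRays x γ t) (f := fun q => μ q p) (g := fun _ => 1)
      fun q hq => ((hμ q hq).mem_Icc p).2
    simpa [raySum] using this
  rw [abs_le]
  constructor <;> linarith [Nat.cast_nonneg (α := ℝ) (criticalRays x γ t).card]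

/-- The supports of distinct ray cut-offs lie in disjoint open quadrants, so near a given ray only
its own cut-off contributes. -/
theorem raySum_eventually_eq_one {t : ℝ} {μ : ℝ × ℝ → ℝ × ℝ → ℝ}
    (hμ : ∀ q ∈ criticalRays x γ t, IsRayCutoff q (μ q)) {q : ℝ × ℝ}
    (hq : q ∈ criticalRays x γ t) {r : ℝ} (hr : 0 < r) (hr1 : 1 ≤ r ^ 2 + r ^ 2) :
    ∀ᶠ p in 𝓝 (q.1 * r, q.2 * r), raySum x γ t μ p = 1 := by
  classical
  have hz : ∀ q' ∈ (criticalRays x γ t).erase q, ∀ᶠ p in 𝓝 (q.1 * r, q.2 * r), μ q' p = 0 := by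
    intro q' hq'
    obtain ⟨hne, hmem⟩ := Finset.mem_erase.1 hq'
    refine notMem_tsupport_iff_eventuallyEq.1 fun hsupp => hne ?_
    obtain ⟨h1, h2⟩ := (hμ q' hmem).support hsupp
    obtain ⟨e1, e2⟩ := eq_or_eq_of_mem_signPairs (mem_criticalRays_iff.1 hmem).1
    obtain ⟨e3, e4⟩ := eq_or_eq_of_mem_signPairs (mem_criticalRays_iff.1 hq).1
    ext
    · rcases e1 with e | e <;> rcases e3 with e' | e' <;> rw [e, e'] at h1 ⊢ <;> linarith
    · rcases e2 with e | e <;> rcases e4 with e' | e' <;> rw [e, e'] at h2 ⊢ <;> linarith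
  filter_upwards [(hμ q hq).eq_one r hr hr1, (Filter.eventually_all_finset _).2 hz] with p h1 h2
  rw [raySum, ← Finset.add_sum_erase _ _ hq, h1, Finset.sum_eq_zero h2, add_zero]

theorem low_eventually_eq_one {ν : ℝ × ℝ → ℝ} (hν : IsLowCutoff ν) {p : ℝ × ℝ}
    (hp : p.1 ^ 2 + p.2 ^ 2 < 1) : ∀ᶠ z in 𝓝 p, ν z = 1 := by
  have hopen : IsOpen {z : ℝ × ℝ | z.1 ^ 2 + z.2 ^ 2 < 1} :=
    isOpen_lt (by fun_prop) continuous_const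
  filter_upwards [hopen.mem_nhds hp] with z hz using hν.eq_one z (le_of_lt hz)

/-- `χ` removes the axes. Of each critical ray, `1 - μ` removes the part with `2r² ≥ 1` and `1 - ν`
the part inside the open unit disc, so together they remove all of it. -/
theorem isPhaseFunctionOn_tsupport_remainder (hχ : IsHighCutoff χ) {t : ℝ} {ν : ℝ × ℝ → ℝ}
    (hν : IsLowCutoff ν) {μ : ℝ × ℝ → ℝ × ℝ → ℝ}
    (hμ : ∀ q ∈ criticalRays x γ t, IsRayCutoff q (μ q)) :
    IsPhaseFunctionOn (corrPhase x γ t)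
      (tsupport fun p => (1 - ν p) * (1 - raySum x γ t μ p) * corrAmp χ γ p) := by
  refine isPhaseFunctionOn_corrPhase ?_ ?_ ?_
  · rintro ⟨ξ, η⟩ hp (rfl : ξ = 0)
    refine notMem_tsupport_of_eventually_zero ?_ hp
    filter_upwards [corrAmp_eventually_zero_fst hχ η] with z hz
    rw [hz, mul_zero]
  · rintro ⟨ξ, η⟩ hp (rfl : η = 0)
    refine notMem_tsupport_of_eventually_zero ?_ hp
    filter_upwards [corrAmp_eventually_zero_snd hχ ξ] with z hz
    rw [hz, mul_zero]
  · intro q hq r hr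
    refine notMem_tsupport_of_eventually_zero ?_
    rcases le_or_gt 1 (r ^ 2 + r ^ 2) with h | h
    · filter_upwards [raySum_eventually_eq_one hμ hq hr h] with z hz
      rw [hz, sub_self, mul_zero, zero_mul]
    · obtain ⟨e1, e2⟩ := eq_or_eq_of_mem_signPairs (mem_criticalRays_iff.1 hq).1
      have h1 : (q.1 * r) ^ 2 + (q.2 * r) ^ 2 < 1 := by
        rcases e1 with e | e <;> rcases e2 with e' | e' <;> rw [e, e'] <;> linarith
      filter_upwards [low_eventually_eq_one hν (p := (q.1 * r, q.2 * r)) h1] with z hz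
      rw [hz, sub_self, zero_mul, zero_mul]

/-- All three kinds of pieces are bounded continuous multiples of the amplitude, hence
`CorrDominated`, and the identity is additivity of absolutely convergent integrals. The first piece
is smooth because its amplitude has compact support. -/
theorem corrProduct_decomposition (hχ : IsHighCutoff χ) (hγ : 0 < γ) (t : ℝ) {ν : ℝ × ℝ → ℝ}
    (hν : IsLowCutoff ν) {μ : ℝ × ℝ → ℝ × ℝ → ℝ}
    (hμ : ∀ q ∈ criticalRays x γ t, IsRayCutoff q (μ q)) :
    ∃ (S : ℝ → ℂ) (O : Distr) (F : ℝ × ℝ → Distr),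
      (∀ s, S s = ∫ p : ℝ × ℝ, ((ν p * (1 - raySum x γ t μ p) * corrAmp χ γ p : ℝ) : ℂ) *
        Complex.exp (Complex.I * (corrPhase x γ t s p : ℂ))) ∧
      ContDiff ℝ ∞ S ∧
      IsOscInt (corrPhase x γ t)
        (fun p => (1 - ν p) * (1 - raySum x γ t μ p) * corrAmp χ γ p) O ∧
      (∀ q ∈ criticalRays x γ t,
        IsCutoffLimit (corrPhase x γ t) (fun p => μ q p * corrAmp χ γ p) (F q) ∧
        MemLp (fun p => μ q p * corrAmp χ γ p) 2 ∧
        ∃ hg : MemLp (lineIntegral (fun p => μ q p * corrAmp χ γ p) q) 2 volume,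
          ∀ ψ : TestFn, F q ψ = ∫ s : ℝ, (ψ s : ℂ) *
            (𝓕 (hg.toLp _) : Lp ℂ 2 (volume : Measure ℝ)) ((q.1 * x - s) / (2 * Real.pi))) ∧
      ∀ ψ : TestFn, corrProduct hχ hγ x t ψ =
        (∫ s : ℝ, (ψ s : ℂ) * S s) + O ψ + ∑ q ∈ criticalRays x γ t, F q ψ := by
  classical
  have hm := contDiff_raySum hμ
  have hmb := abs_one_sub_raySum_le hμ
  obtain ⟨N, hN⟩ := hν.smooth.continuous.bounded_above_of_compact_support hν.compact
  have hN' : ∀ p, |ν p| ≤ N := hN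
  have hb₀ : CorrDominated fun p => ν p * (1 - raySum x γ t μ p) * corrAmp χ γ p := by
    refine corrDominated_mul_corrAmp hχ hγ
      (hν.smooth.continuous.mul (continuous_const.sub hm.continuous))
      (M := N * (1 + (criticalRays x γ t).card)) fun p => ?_
    rw [abs_mul]
    exact mul_le_mul (hN' p) (hmb p) (abs_nonneg _) ((abs_nonneg _).trans (hN' p))
  have hb₁ : CorrDominated fun p => (1 - ν p) * (1 - raySum x γ t μ p) * corrAmp χ γ p := by
    refine corrDominated_mul_corrAmp hχ hγ
      ((continuous_const.sub hν.smooth.continuous).mul (continuous_const.sub hm.continuous))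
      (M := (1 + N) * (1 + (criticalRays x γ t).card)) fun p => ?_
    have h1 : |1 - ν p| ≤ 1 + N := by
      have := abs_sub (1 : ℝ) (ν p)
      rw [abs_one] at this
      linarith [hN' p]
    rw [abs_mul]
    exact mul_le_mul h1 (hmb p) (abs_nonneg _) ((abs_nonneg _).trans h1)
  have hbq : ∀ q ∈ criticalRays x γ t, CorrDominated fun p => μ q p * corrAmp χ γ p := by
    intro q hq
    refine corrDominated_mul_corrAmp hχ hγ (hμ q hq).smooth.continuous (M := 1) fun p => ?_
    obtain ⟨h0, h1⟩ := (hμ q hq).mem_Icc p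
    rwa [abs_of_nonneg h0]
  have hcs : HasCompactSupport fun p => ν p * (1 - raySum x γ t μ p) * corrAmp χ γ p :=
    hν.compact.mul_right.mul_right
  refine ⟨fun s => ∫ p : ℝ × ℝ, ((ν p * (1 - raySum x γ t μ p) * corrAmp χ γ p : ℝ) : ℂ) *
      Complex.exp (Complex.I * (corrPhase x γ t s p : ℂ)), corrDistr x γ t hb₁,
    fun q => if hq : q ∈ criticalRays x γ t then corrDistr x γ t (hbq q hq) else 0,
    fun s => rfl, ?_, ⟨?_, isPhaseFunctionOn_tsupport_remainder hχ hν hμ,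
      isCutoffLimit_corrDistr x γ t hb₁⟩, fun q hq => ?_, fun ψ => ?_⟩
  · have hS : (fun s => ∫ p : ℝ × ℝ, ((ν p * (1 - raySum x γ t μ p) * corrAmp χ γ p : ℝ) : ℂ) *
        Complex.exp (Complex.I * (corrPhase x γ t s p : ℂ))) =
        fun s : ℝ => ∫ p : ℝ × ℝ, (((ν p * (1 - raySum x γ t μ p) * corrAmp χ γ p : ℝ) : ℂ) *
          Complex.exp (Complex.I * (corrShift x γ t p : ℂ))) *
          Complex.exp (Complex.I * (s * corrFreq p : ℝ)) := by
      ext s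
      congr 1
      ext p
      rw [corrPhase_eq, Complex.ofReal_add, mul_add, Complex.exp_add]
      ring
    rw [hS]
    refine contDiff_integral_mul_exp continuous_corrFreq ((Complex.continuous_ofReal.comp
      hb₀.continuous).mul (continuous_exp_I_mul (continuous_corrShift x γ t))) ?_
    exact (hcs.comp_left (g := fun r : ℝ => (r : ℂ)) Complex.ofReal_zero).mul_right
  · exact ((contDiff_const.sub hν.smooth).mul (contDiff_const.sub hm)).mul (contDiff_corrAmp hχ hγ)
  · simp only [dif_pos hq]
    have hg := memLp_lineIntegral (hbq q hq) (mem_criticalRays_iff.1 hq).1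
    refine ⟨isCutoffLimit_corrDistr x γ t (hbq q hq), (hbq q hq).memLp, hg, fun ψ => ?_⟩
    refine corrDistr_eq_integral_fourier (hbq q hq) hq (fun p hp => ?_) ψ hg
    exact (hμ q hq).support (subset_tsupport _ (left_ne_zero_of_mul hp))
  · have hS : (∫ s : ℝ, (ψ s : ℂ) * ∫ p : ℝ × ℝ,
        ((ν p * (1 - raySum x γ t μ p) * corrAmp χ γ p : ℝ) : ℂ) *
          Complex.exp (Complex.I * (corrPhase x γ t s p : ℂ))) = corrDistr x γ t hb₀ ψ :=
      integral_mul_integral_exp hb₀.continuous hcs continuous_corrFreq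
        (continuous_corrShift x γ t) (corrPhase_eq x γ t) ψ
    have hF : ∑ q ∈ criticalRays x γ t, (if hq : q ∈ criticalRays x γ t then
        corrDistr x γ t (hbq q hq) else (0 : Distr)) ψ =
        ∑ q ∈ (criticalRays x γ t).attach, corrDistr x γ t (hbq q.1 q.2) ψ := by
      rw [← Finset.sum_attach]
      exact Finset.sum_congr rfl fun q _ => by rw [dif_pos q.2]
    rw [hS, hF]
    simp only [corrProduct, corrDistr_apply]
    have hsum := integrable_finsetSum (criticalRays x γ t).attach
      fun q _ => (hbq q.1 q.2).integrable x γ t ψ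
    rw [← integral_finsetSum _ fun q _ => (hbq q.1 q.2).integrable x γ t ψ,
      ← integral_add (hb₀.integrable x γ t ψ) (hb₁.integrable x γ t ψ)]
    refine Eq.trans ?_ (integral_add
      ((hb₀.integrable x γ t ψ).add (hb₁.integrable x γ t ψ)) hsum)
    congr 1
    ext p
    rw [← Finset.sum_mul, ← Finset.sum_mul, ← Complex.ofReal_sum,
      Finset.sum_attach _ (fun q => μ q p * corrAmp χ γ p), ← Finset.sum_mul]
    change _ = _ + (((raySum x γ t μ p * corrAmp χ γ p : ℝ) : ℂ) * _ * _)
    push_cast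
    ring

end Decomposition

end

theorem mainTheorem4 (χ : ℝ → ℝ) (hχ : ContDiff ℝ ∞ χ) (hχ_even : ∀ ξ, χ (-ξ) = χ ξ)
    (hχ_zero : ∀ᶠ ξ in 𝓝 0, χ ξ = 0) (hχ_one : ∀ ξ, 1 ≤ |ξ| → χ ξ = 1)
    (γ x : ℝ) (hγ : 0 < γ) (hx : 0 < x) :
    ∃ (u v : Distr) (w : ℝ → Distr),
      -- the factors `u_x` and `v_x` as oscillatory integrals
      IsOscInt (wavePhase x) (waveAmp χ 1) u ∧
      IsOscInt (wavePhase (x / γ)) (waveAmp χ γ) v ∧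
      -- `w_{x,t}` is the product of `u_x` and the conjugate of `T_t v_x`
      (∀ t, IsFourierProduct u (v.translate t).conj (w t)) ∧
      (∀ t, t ∉ degenerateTimes x γ → IsHormanderProduct u (v.translate t).conj (w t)) ∧
      -- `w_{x,t}` is given by the double integral, an oscillatory integral off degenerate times
      (∀ t, IsCutoffLimit (corrPhase x γ t) (corrAmp χ γ) (w t)) ∧
      (∀ t, t ∉ degenerateTimes x γ → IsOscInt (corrPhase x γ t) (corrAmp χ γ) (w t)) ∧
      -- smooth part, oscillatory integral and Fourier transform of `L²` functions
      (∀ (t : ℝ) (ν : ℝ × ℝ → ℝ) (μ : ℝ × ℝ → ℝ × ℝ → ℝ), IsLowCutoff ν →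
        (∀ q ∈ criticalRays x γ t, IsRayCutoff q (μ q)) →
        ∃ (S : ℝ → ℂ) (O : Distr) (F : ℝ × ℝ → Distr),
          (∀ s, S s = ∫ p : ℝ × ℝ,
            ((ν p * (1 - ∑ q ∈ criticalRays x γ t, μ q p) * corrAmp χ γ p : ℝ) : ℂ) *
              Complex.exp (Complex.I * (corrPhase x γ t s p : ℂ))) ∧
          ContDiff ℝ ∞ S ∧
          IsOscInt (corrPhase x γ t) (fun p =>
            (1 - ν p) * (1 - ∑ q ∈ criticalRays x γ t, μ q p) * corrAmp χ γ p) O ∧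
          (∀ q ∈ criticalRays x γ t,
            IsCutoffLimit (corrPhase x γ t) (fun p => μ q p * corrAmp χ γ p) (F q) ∧
            MemLp (fun p => μ q p * corrAmp χ γ p) 2 ∧
            ∃ hg : MemLp (lineIntegral (fun p => μ q p * corrAmp χ γ p) q) 2 volume,
              ∀ ψ : TestFn, F q ψ = ∫ s : ℝ, (ψ s : ℂ) *
                (𝓕 (hg.toLp _) : Lp ℂ 2 (volume : Measure ℝ))
                  ((q.1 * x - s) / (2 * Real.pi))) ∧
          ∀ ψ : TestFn, w t ψ =
            (∫ s : ℝ, (ψ s : ℂ) * S s) + O ψ + ∑ q ∈ criticalRays x γ t, F q ψ) ∧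
      -- weak continuity, and weak smoothness off the degenerate times
      (∀ ψ : TestFn, Continuous (fun t => w t ψ)) ∧
      (∀ ψ : TestFn, ContDiffOn ℝ ∞ (fun t => w t ψ) (degenerateTimes x γ)ᶜ) := by
  have h : IsHighCutoff χ := ⟨hχ, hχ_even, hχ_zero, hχ_one⟩
  exact ⟨waveDistr h one_pos x, waveDistr h hγ (x / γ), fun t => corrProduct h hγ x t,
    isOscInt_waveDistr h one_pos x, isOscInt_waveDistr h hγ (x / γ),
    isFourierProduct_corrProduct h hγ x,
    fun t ht => ⟨wffavorable_waveDistr h hγ ht, isFourierProduct_corrProduct h hγ x t⟩,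
    fun t => isCutoffLimit_corrDistr x γ t _, fun t ht => isOscInt_corrProduct h hγ ht,
    fun t ν μ hν hμ => corrProduct_decomposition h hγ t hν hμ,
    continuous_corrProduct h hγ, contDiffOn_corrProduct h hγ⟩
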